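/- **Setting.** Let $\epsilon>0$, $\lambda>0$, let $z_1,\dots,z_P$ have $\operatorname{Im} z_p>0$ and $\operatorname{Re} z_1<\dots<\operatorname{Re} z_P$, and let $c_1,\dots,c_P$ be nonzero complex numbers with $\sum_{p=1}^P(c_p+c_p^*)=0$. Let $v_1,\dots,v_P\in\mathbb C$ be arbitrary. With $\operatorname{Log}$ the principal branch, put $$f(x)=\sum_{p=1}^P\Big[c_p\big(\operatorname{Log}(i(x-z_p))+\tfrac{\pi i}{2}\big)+c_p^*\big(\operatorname{Log}(-i(x-z_p^*))-\tfrac{\pi i}{2}\big)\Big],\qquad h(x)=\lambda x+f(x),$$ and let $G$ be the domain of analyticity of $f$, i.e. $\mathbb C$ without the vertical half-lines going up from each $z_p$ and down from each $z_p^*$. For $x\in G\cup\{z_1,\dots,z_P\}$ let $\ell_0(x)$ be any piecewise continuously differentiable contour that lies in $G$ (except for its end point if $x=z_m$), originates at $-i\infty$ in the half-plane $G_0=\{\operatorname{Re}x<\operatorname{Re}z_1\}$, and ends at $x$. (The contour is parametrized by $t\in(-\infty,0]$ with bounded speed, nonzero velocity at its end point, and imaginary part at most $at$ for some $a>0$ as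 $t\to-\infty$.) For $x\in G$ define $$W_+(x)=-\frac{i}{\epsilon}\,e^{ih(x)/\epsilon}\int_{\ell_0(x)}e^{-ih(z)/\epsilon}\Big(\lambda+\sum_{p=1}^P\frac{v_p}{z-z_p}\Big)dz .$$ For each $m$ define $H_m$ on $G$ by $$(i(z-z_m))^{-ic_m/\epsilon-1}H_m(z)=-e^{-ih(z)/\epsilon}\Big(\lambda+\sum_{p=1}^P\frac{v_p}{z-z_p}\Big)$$ (principal power); $H_m$ extends analytically to a neighborhood of $z_m$. Let $\mu_m=\lfloor\operatorname{Re}(ic_m/\epsilon)\rfloor$ and $\omega_m=ic_m/\epsilon-\mu_m$, so that $0\le\operatorname{Re}\omega_m<1$. **Proposition.** $W_+$ is analytic in the upper half-plane (i.e. its restriction to $G\cap\{\operatorname{Im}x>0\}$ extends to an analytic function on $\{\operatorname{Im}x>0\}$) if and only if for each $m=1,\dots,P$: - if $\operatorname{Re}(ic_m/\epsilon)<0$, then $\displaystyle\int_{\ell_0(z_m)}(i(z-z_m))^{-ic_m/\epsilon-1}H_m(z)\,dz=0$; - if $\operatorname{Re}(ic_m/\epsilon)\ge0$ and $\omega_m\ne0$,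 then $\displaystyle\int_{\ell_0(z_m)}(i(z-z_m))^{-\omega_m}\,\frac{d^{\mu_m+1}H_m}{dz^{\mu_m+1}}(z)\,dz=0$; - if $\operatorname{Re}(ic_m/\epsilon)\ge0$ and $\omega_m=0$, then $\displaystyle\operatorname*{Res}_{z=z_m}\frac{H_m(z)}{(z-z_m)^{\mu_m+1}}=0$. -/

import Mathlib

open Complex Filter Topology MeasureTheory Set

noncomputable section

namespace BenjaminOno

variable {P : ℕ}

/-- The antiderivative
`f(x) = ∑ₚ cₚ (Log(i(x - zₚ)) + πi/2) + c.c.` of the rational potential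
`u₀(x) = ∑ₚ cₚ / (x - zₚ) + c.c.`; the term "c.c." is the complex conjugate for real `x`,
continued analytically off the real line. `Complex.log` is the principal branch. -/
def f (c z : Fin P → ℂ) (x : ℂ) : ℂ :=
  ∑ p, (c p * (log (I * (x - z p)) + Real.pi * I / 2)
    + starRingEnd ℂ (c p) * (log (-I * (x - starRingEnd ℂ (z p))) - Real.pi * I / 2))

/-- `h(x; lam) = lam x + f(x)`. -/
def h (c z : Fin P → ℂ) (lam : ℝ) (x : ℂ) : ℂ := lam * x + f c z x

/-- The domain of analyticity `G` of `f`: the plane with the vertical half-lines going up from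
each `zₚ` and going down from each conjugate of `zₚ` removed. -/
def G (z : Fin P → ℂ) : Set ℂ :=
  {x | ∀ p, I * (x - z p) ∈ slitPlane ∧ -I * (x - starRingEnd ℂ (z p)) ∈ slitPlane}

/-- `γ`, restricted to parameters `t ≤ 0`, is a contour `ℓ₀(x)`: a piecewise continuously
differentiable curve in `G` (except that the end point `x` itself need not lie in `G`), which
originates at `-i∞` in the half-plane `G₀` to the left of all `zₚ` and ends at `x`.
The speed is bounded, the final velocity is nonzero, and the imaginary part tends to `-∞` at
least linearly in the parameter, so that the exponentially decaying integrands below are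
absolutely integrable. -/
structure IsEllZero (z : Fin P → ℂ) (γ : ℝ → ℂ) (x : ℂ) : Prop where
  continuousOn : ContinuousOn γ (Iic 0)
  piecewise_C1 : ∃ (S : Finset ℝ) (C : ℝ), ∀ t < 0, t ∉ S →
    ContDiffAt ℝ 1 γ t ∧ ‖deriv γ t‖ ≤ C
  mem_G : ∀ t < 0, γ t ∈ G z
  origin_re : ∀ᶠ t in atBot, ∀ p, (γ t).re < (z p).re
  origin_im : ∃ a > 0, ∀ᶠ t in atBot, (γ t).im ≤ a * t
  endpoint : γ 0 = x
  end_velocity : ∃ w : ℂ, w ≠ 0 ∧ HasDerivWithinAt γ w (Iic 0) 0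

/-- The contour integral `∫_γ g(z) dz` over a contour parametrized by `t ≤ 0`. -/
def contourIntegral (γ : ℝ → ℂ) (g : ℂ → ℂ) : ℂ := ∫ t in Iic (0 : ℝ), g (γ t) * deriv γ t

/-- The inhomogeneity `lam + ∑ₚ vₚ / (x - zₚ)`. -/
def forcing (z v : Fin P → ℂ) (lam : ℝ) (x : ℂ) : ℂ := lam + ∑ p, v p / (x - z p)

/-- The function `W₊(x; lam)` given by the integral formula
`-(i/ε) e^{ih(x)/ε} ∫ e^{-ih(z)/ε} (lam + ∑ₚ vₚ / (z - zₚ)) dz`, the integral being taken over the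
contour `γ` from `-i∞` in `G₀` to `x` (the integral from `-∞` to `x` with its contour rotated at
infinity into the lower half-plane). -/
def Wplus (ε : ℝ) (c z v : Fin P → ℂ) (lam : ℝ) (γ : ℝ → ℂ) (x : ℂ) : ℂ :=
  -(I / ε) * exp (I * h c z lam x / ε) *
    contourIntegral γ (fun s => exp (-I * h c z lam s / ε) * forcing z v lam s)

/-- The solution `H` of
`(i(s - zₘ))^{-i cₘ/ε - 1} H(s) = - e^{-ih(s)/ε} (lam + ∑ₚ vₚ / (s - zₚ))` for `s ≠ zₘ`. -/
def HFormula (ε : ℝ) (c z v : Fin P → ℂ) (lam : ℝ) (m : Fin P) (s : ℂ) : ℂ :=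
  -exp (-I * h c z lam s / ε) * forcing z v lam s / (I * (s - z m)) ^ (-(I * c m / ε) - 1)

/-- `Hₘ`, with its removable singularity at `zₘ` filled in. -/
def H (ε : ℝ) (c z v : Fin P → ℂ) (lam : ℝ) (m : Fin P) : ℂ → ℂ :=
  Function.update (HFormula ε c z v lam m) (z m)
    (limUnder (𝓝[≠] (z m)) (HFormula ε c z v lam m))

/-- `g` has an isolated singularity (possibly removable) at `z₀`, with residue `a` there. -/
def HasResidue (g : ℂ → ℂ) (z₀ a : ℂ) : Prop :=
  (∀ᶠ s in 𝓝[≠] z₀, AnalyticAt ℂ g s) ∧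
    ∀ᶠ r : ℝ in 𝓝[>] 0, (2 * Real.pi * I)⁻¹ * (∮ s in C(z₀, r), g s) = a

/-- `μₘ`, the floor of `Re(i cₘ / ε)`. -/
def mu (ε : ℝ) (c : Fin P → ℂ) (m : Fin P) : ℤ := ⌊(I * c m / ε).re⌋

/-- `ωₘ = i cₘ / ε - μₘ`, so that `0 ≤ Re ωₘ < 1`. -/
def omega (ε : ℝ) (c : Fin P → ℂ) (m : Fin P) : ℂ := I * c m / ε - mu ε c m

/-- The function `W`, given on `G`, is analytic in the open upper half-plane: it agrees there,
off the branch cuts of `f`, with a function analytic in the whole upper half-plane. -/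
def AnalyticInUpperHalfPlane (z : Fin P → ℂ) (W : ℂ → ℂ) : Prop :=
  ∃ F : ℂ → ℂ, AnalyticOnNhd ℂ F {x | 0 < x.im} ∧ ∀ x ∈ G z, 0 < x.im → F x = W x

end BenjaminOno

end

open BenjaminOno

/-! Up to the factor `-(I / ε)`, W₊ is e^{ih/ε} times the primitive Φ of its integrand that vanishes
at -i∞ (`exists_normalized_primitive`). It is therefore holomorphic on G, and analyticity in the
upper half-plane is a separate question for each m: does W₊ extend across the cut above z_m, branch
point included? This is studied in the slab around that cut (`analyticInUpperHalfPlane_iff`).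

Put u = i(w - z_m) and α = i c_m/ε. In the slab e^{ih/ε} is u^α times a nonvanishing holomorphic
function, and the integrand is -u^{-α-1} H with H holomorphic. Suppose Re α < N and α is none of 0,
…, N - 1. Integrating by parts N times leaves the locally integrable u^{N-α-1} H⁽ᴺ⁾, whose primitive
is a constant plus u^{N-α} times a holomorphic function. Hence kΦ = L + u^{-α} E with k ≠ 0, L
constant and E holomorphic (`exists_local_form`). Since u^{N-α} vanishes at z_m and all the terms
vanish at -i∞, L is exactly the contour integral of u^{N-α-1} H⁽ᴺ⁾ up to z_m.

Multiplying by e^{ih/ε}, W₊ is a nonvanishing holomorphic factor times L u^α + E, so it extends if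
and only if L u^α does (`extendsAcross_Wplus_iff`). If Re α < 0 this power is unbounded at z_m; if α
is not an integer it jumps across the cut. Either way L = 0 is forced (`extendsAcross_cpow_iff`).
The choices N = 0 and N = μ + 1 give the first two conditions.

If α = n is a natural number, the constant of integration is harmless, but a term proportional to
H⁽ⁿ⁾(z_m) log u appears (`exists_local_form_log`). As u^n log u jumps across the cut, its
coefficient must vanish (`extendsAcross_log_iff`), which is the residue condition. -/

noncomputable section

namespace BenjaminOno

variable {P : ℕ}

/-! ### Primitives, the singular Euler equation, and boundary values of the logarithm. -/

/-- On a domain star-shaped about `z₀`, the singular equation `(z - z₀) A' + β A = g` with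
`0 < Re β` has a solution that is holomorphic in the whole domain. -/
theorem exists_solution_euler_equation {D : Set ℂ} (hD : IsOpen D) {z₀ : ℂ}
    (hs : StarConvex ℝ z₀ D) {g : ℂ → ℂ} (hg : DifferentiableOn ℂ g D) {β : ℂ} (hβ : 0 < β.re) :
    ∃ A A' : ℂ → ℂ, ∀ z ∈ D, HasDerivAt A (A' z) z ∧ (z - z₀) * A' z + β * A z = g z := by
  have hmem : ∀ z ∈ D, ∀ τ ∈ Icc (0 : ℝ) 1, z₀ + τ * (z - z₀) ∈ D := by
    intro z hz τ hτ
    have := hs.add_smul_sub_mem hz hτ.1 hτ.2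
    simpa using this
  have hg' : DifferentiableOn ℂ (deriv g) D := hg.deriv hD
  have hcpow : IntervalIntegrable (fun τ : ℝ => (τ : ℂ) ^ (β - 1)) volume 0 1 :=
    intervalIntegral.intervalIntegrable_cpow' (by simpa using hβ)
  have hcont : ∀ z ∈ D, ∀ φ : ℂ → ℂ, DifferentiableOn ℂ φ D →
      ContinuousOn (fun τ : ℝ => φ (z₀ + τ * (z - z₀))) (uIcc 0 1) := by
    intro z hz φ hφ
    refine hφ.continuousOn.comp (by fun_prop) ?_
    intro τ hτ
    rw [uIcc_of_le zero_le_one] at hτ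
    exact hmem z hz τ hτ
  have hint' : ∀ z ∈ D, IntervalIntegrable
      (fun τ : ℝ => (τ : ℂ) ^ (β - 1) * (deriv g (z₀ + τ * (z - z₀)) * τ)) volume 0 1 :=
    fun z hz => hcpow.mul_continuousOn
      ((hcont z hz _ hg').mul continuous_ofReal.continuousOn)
  -- The formal solution is (z - z₀)^{-β} ∫ (s - z₀)^{β-1} g(s) ds, taken from z₀ to z. Substituting
  -- s = z₀ + τ(z - z₀) cancels the powers of z - z₀, so no branch cut remains.
  refine ⟨fun z => ∫ τ in (0 : ℝ)..1, (τ : ℂ) ^ (β - 1) * g (z₀ + τ * (z - z₀)),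
    fun z => ∫ τ in (0 : ℝ)..1, (τ : ℂ) ^ (β - 1) * (deriv g (z₀ + τ * (z - z₀)) * τ), ?_⟩
  intro z hz
  constructor
  · obtain ⟨r, hr, hrD⟩ := Metric.isOpen_iff.1 hD z hz
    set K : Set ℂ := (fun q : ℝ × ℂ => z₀ + q.1 * (q.2 - z₀)) ''
      (Icc (0 : ℝ) 1 ×ˢ Metric.closedBall z (r / 2))
    have hKc : IsCompact K :=
      (isCompact_Icc.prod (isCompact_closedBall z (r / 2))).image (by fun_prop)
    have hball : Metric.closedBall z (r / 2) ⊆ D :=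
      (Metric.closedBall_subset_ball (by linarith)).trans hrD
    have hKD : K ⊆ D := by
      rintro _ ⟨⟨τ, w⟩, ⟨hτ, hw⟩, rfl⟩
      exact hmem w (hball hw) τ hτ
    obtain ⟨M, hM⟩ := hKc.exists_bound_of_continuousOn (hg'.continuousOn.mono hKD)
    refine (intervalIntegral.hasDerivAt_integral_of_dominated_loc_of_deriv_le
      (F := fun (z : ℂ) (τ : ℝ) => (τ : ℂ) ^ (β - 1) * g (z₀ + τ * (z - z₀)))
      (F' := fun (z : ℂ) (τ : ℝ) => (τ : ℂ) ^ (β - 1) * (deriv g (z₀ + τ * (z - z₀)) * τ))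
      (s := Metric.ball z (r / 2)) (bound := fun τ => ‖(τ : ℂ) ^ (β - 1)‖ * M)
      (Metric.ball_mem_nhds z (by linarith)) ?_ ?_ ?_ ?_ ?_ ?_).2
    · filter_upwards [hD.mem_nhds hz] with w hw
      exact (hcpow.mul_continuousOn (hcont w hw g hg)).aestronglyMeasurable_restrict_uIoc
    · exact hcpow.mul_continuousOn (hcont z hz g hg)
    · exact (hint' z hz).aestronglyMeasurable_restrict_uIoc
    · refine Eventually.of_forall fun τ hτ w hw => ?_
      rw [uIoc_of_le zero_le_one] at hτ
      rw [norm_mul, norm_mul]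
      have h1 : ‖deriv g (z₀ + τ * (w - z₀))‖ ≤ M :=
        hM _ ⟨(τ, w), ⟨⟨hτ.1.le, hτ.2⟩, Metric.ball_subset_closedBall hw⟩, rfl⟩
      have h2 : ‖(τ : ℂ)‖ ≤ 1 := by
        rw [norm_real, Real.norm_of_nonneg hτ.1.le]; exact hτ.2
      gcongr
      calc _ ≤ M * 1 := by gcongr; exact (norm_nonneg _).trans h1
        _ = M := mul_one M
    · exact hcpow.norm.mul_const M
    · refine Eventually.of_forall fun τ hτ w hw => ?_
      rw [uIoc_of_le zero_le_one] at hτ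
      have h1 : HasDerivAt g (deriv g (z₀ + τ * (w - z₀))) (z₀ + τ * (w - z₀)) :=
        (hg.differentiableAt (hD.mem_nhds
          (hmem w (hball (Metric.ball_subset_closedBall hw)) τ ⟨hτ.1.le, hτ.2⟩))).hasDerivAt
      have h2 : HasDerivAt (fun w : ℂ => z₀ + τ * (w - z₀)) (τ : ℂ) w := by
        simpa using (((hasDerivAt_id w).sub_const z₀).const_mul (τ : ℂ)).const_add z₀
      exact (h1.comp w h2).const_mul _
  · have hβ0 : β ≠ 0 := by rintro rfl; simp at hβ
    -- The integrand is the τ-derivative of τ^β g(z₀ + τ(z - z₀)); the boundary term at 0 vanishes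
    -- because Re β > 0.
    have key : ∫ τ in (0 : ℝ)..1, (β * ((τ : ℂ) ^ (β - 1) * g (z₀ + τ * (z - z₀))) +
        (z - z₀) * ((τ : ℂ) ^ (β - 1) * (deriv g (z₀ + τ * (z - z₀)) * τ))) =
        (1 : ℝ) ^ β * g (z₀ + (1 : ℝ) * (z - z₀)) - (0 : ℝ) ^ β * g (z₀ + (0 : ℝ) * (z - z₀)) := by
      have hc := hcont z hz g hg
      rw [uIcc_of_le zero_le_one] at hc
      refine intervalIntegral.integral_eq_sub_of_hasDerivAt_of_le
        (f := fun τ : ℝ => (τ : ℂ) ^ β * g (z₀ + τ * (z - z₀))) zero_le_one ?_ ?_ ?_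
      · refine ContinuousOn.mul ?_ hc
        exact (continuous_ofReal_cpow_const hβ).continuousOn
      · intro τ hτ
        have h1 : HasDerivAt (fun τ : ℝ => (τ : ℂ) ^ β) (β * (τ : ℂ) ^ (β - 1)) τ :=
          hasDerivAt_ofReal_cpow_const hτ.1.ne' hβ0
        have h2 : HasDerivAt g (deriv g (z₀ + τ * (z - z₀))) (z₀ + τ * (z - z₀)) :=
          (hg.differentiableAt (hD.mem_nhds
            (hmem z hz τ ⟨hτ.1.le, hτ.2.le⟩))).hasDerivAt
        have h3 : HasDerivAt (fun τ : ℝ => z₀ + (τ : ℂ) * (z - z₀)) (z - z₀) τ := by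
          simpa using ((hasDerivAt_id τ).ofReal_comp.mul_const (z - z₀)).const_add z₀
        have h4 := h1.mul (h2.comp τ h3)
        refine h4.congr_deriv ?_
        have hτ0 : (τ : ℂ) ≠ 0 := ofReal_ne_zero.2 hτ.1.ne'
        rw [cpow_sub _ _ hτ0, cpow_one]
        simp only [Function.comp]
        field_simp
      · exact ((hcpow.mul_continuousOn (hcont z hz g hg)).const_mul β).add
          ((hint' z hz).const_mul (z - z₀))
    rw [intervalIntegral.integral_add
      ((hcpow.mul_continuousOn (hcont z hz g hg)).const_mul β)
      ((hint' z hz).const_mul (z - z₀)),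
      intervalIntegral.integral_const_mul, intervalIntegral.integral_const_mul] at key
    rw [add_comm, key]
    simp [zero_cpow hβ0]

/-- Holomorphic functions on star-shaped domains have primitives. -/
theorem exists_primitive_of_starConvex {D : Set ℂ} (hD : IsOpen D) {z₀ : ℂ}
    (hs : StarConvex ℝ z₀ D) {g : ℂ → ℂ} (hg : DifferentiableOn ℂ g D) :
    ∃ Φ : ℂ → ℂ, ∀ z ∈ D, HasDerivAt Φ (g z) z := by
  obtain ⟨A, A', hA⟩ := exists_solution_euler_equation hD hs hg (β := 1) (by simp)
  refine ⟨fun z => (z - z₀) * A z, fun z hz => ?_⟩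
  obtain ⟨h1, h2⟩ := hA z hz
  refine (((hasDerivAt_id z).sub_const z₀).mul h1).congr_deriv ?_
  simp only [id]
  linear_combination h2

/-- A holomorphic function on an open set that contains, with each of its points, the vertical
segment down or up to the real line, and that contains the real line, has a primitive. -/
theorem exists_primitive_of_vertical_segments {U : Set ℂ} (hU : IsOpen U)
    (hseg : ∀ w ∈ U, segment ℝ (w.re : ℂ) w ⊆ U) (hreal : ∀ x : ℝ, (x : ℂ) ∈ U)
    {g : ℂ → ℂ} (hg : DifferentiableOn ℂ g U) :
    ∃ Φ : ℂ → ℂ, ∀ z ∈ U, HasDerivAt Φ (g z) z := by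
  have hvert : ∀ x : ℝ, ∀ y : ℝ, ∀ s ∈ uIcc (0 : ℝ) y,
      (x : ℂ) + s * I ∈ segment ℝ (x : ℂ) (x + y * I) := by
    intro x y s hs
    rw [← segment_eq_uIcc] at hs
    obtain ⟨a, b, ha, hb, hab, rfl⟩ := hs
    refine ⟨a, b, ha, hb, hab, ?_⟩
    have : (a : ℂ) + b = 1 := by exact_mod_cast hab
    simp only [real_smul, smul_eq_mul, mul_zero, zero_add, ofReal_mul]
    linear_combination (x : ℂ) * this
  have hgreal : Continuous (fun t : ℝ => g t) :=
    continuous_iff_continuousAt.2 fun t =>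
      (hg.continuousOn.continuousAt (hU.mem_nhds (hreal t))).comp continuous_ofReal.continuousAt
  -- Integrate along the real axis, then vertically. Near each point this differs by a constant from
  -- a primitive `Q` on a convex neighbourhood `T` of the vertical segment, so it is differentiable
  -- there.
  refine ⟨fun w => (∫ t in (0 : ℝ)..w.re, g t) + ∫ s in (0 : ℝ)..w.im, g (w.re + s * I) * I, ?_⟩
  intro w hw
  have hcomp : IsCompact (segment ℝ (w.re : ℂ) w) := by
    rw [segment_eq_image]
    exact isCompact_Icc.image (by fun_prop)
  obtain ⟨η, hη, hT⟩ := hcomp.exists_thickening_subset_open hU (hseg w hw)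
  set T := Metric.thickening η (segment ℝ (w.re : ℂ) w)
  have hTo : IsOpen T := Metric.isOpen_thickening
  have hTc : Convex ℝ T := (convex_segment _ _).thickening η
  have hwT : w ∈ T := Metric.self_subset_thickening hη _ (right_mem_segment ℝ _ _)
  obtain ⟨Q, hQ⟩ := exists_primitive_of_starConvex hTo (hTc.starConvex hwT) (hg.mono hT)
  have hreT : ∀ w' ∈ Metric.ball w η, (w'.re : ℂ) ∈ T := by
    intro w' hw'
    refine Metric.mem_thickening_iff.2 ⟨_, left_mem_segment ℝ _ _, ?_⟩
    rw [dist_eq, ← ofReal_sub, norm_real, Real.norm_eq_abs]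
    calc |w'.re - w.re| = |(w' - w).re| := by simp
      _ ≤ ‖w' - w‖ := abs_re_le_norm _
      _ < η := by rwa [← dist_eq]
  have hballT : Metric.ball w η ⊆ T := fun w' hw' =>
    Metric.mem_thickening_iff.2 ⟨_, right_mem_segment ℝ _ _, hw'⟩
  refine ((hQ w hwT).add_const ((∫ t in (0 : ℝ)..w.re, g t) - Q w.re)).congr_of_eventuallyEq ?_
  filter_upwards [Metric.ball_mem_nhds w hη] with w' hw'
  have hsub : segment ℝ (w'.re : ℂ) w' ⊆ T := hTc.segment_subset (hreT w' hw') (hballT hw')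
  have hsubre : ∀ t ∈ uIcc w.re w'.re, (t : ℂ) ∈ T := by
    intro t ht
    rw [← segment_eq_uIcc] at ht
    obtain ⟨a, b, ha, hb, hab, rfl⟩ := ht
    have := hTc (hreT w (Metric.mem_ball_self hη)) (hreT w' hw') ha hb hab
    simpa using this
  have e1 : ∫ t in w.re..w'.re, g t = Q w'.re - Q w.re := by
    refine intervalIntegral.integral_eq_sub_of_hasDerivAt (f := fun t : ℝ => Q t) ?_
      (hgreal.intervalIntegrable _ _)
    intro t ht
    exact (hQ _ (hsubre t ht)).comp_ofReal
  have hin : ∀ s ∈ uIcc 0 w'.im, (w'.re : ℂ) + s * I ∈ T := by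
    intro s hs
    have := hvert w'.re w'.im s hs
    rw [re_add_im] at this
    exact hsub this
  have e2 : ∫ s in (0 : ℝ)..w'.im, g (w'.re + s * I) * I = Q w' - Q w'.re := by
    have : Q w' - Q w'.re = (fun s : ℝ => Q (w'.re + s * I)) w'.im -
        (fun s : ℝ => Q (w'.re + s * I)) 0 := by simp
    rw [this]
    refine intervalIntegral.integral_eq_sub_of_hasDerivAt
      (f := fun s : ℝ => Q (w'.re + s * I)) ?_ ?_
    · intro s hs
      have h1 : HasDerivAt (fun s : ℝ => (w'.re : ℂ) + s * I) I s := by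
        simpa using ((hasDerivAt_id s).ofReal_comp.mul_const I).const_add (w'.re : ℂ)
      exact (hQ _ (hin s hs)).comp s h1
    · refine ContinuousOn.intervalIntegrable ?_
      refine ContinuousOn.mul ?_ continuousOn_const
      exact (hg.mono hT).continuousOn.comp (by fun_prop) hin
  have e3 := intervalIntegral.integral_add_adjacent_intervals
    (hgreal.intervalIntegrable (μ := volume) 0 w.re) (hgreal.intervalIntegrable w.re w'.re)
  rw [e2, ← e3, e1]
  ring

/-- If a function that is continuous at a point of the branch cut of the logarithm agrees off the
cut with `q ∘ log`, then `q` takes the same value at the two boundary values of the logarithm. -/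
theorem eq_boundary_values_of_continuousAt {J q : ℂ → ℂ} (hq : Continuous q) {y : ℝ} (hy : 0 < y)
    (hJ : ContinuousAt J (-y : ℂ)) (h : ∀ᶠ w in 𝓝 (-y : ℂ), w ∈ slitPlane → J w = q (log w)) :
    q (Real.log y + Real.pi * I) = q (Real.log y - Real.pi * I) := by
  have hre : (-(y : ℂ)).re < 0 := by simpa
  have him : (-(y : ℂ)).im = 0 := by simp
  have hn : ‖(-(y : ℂ))‖ = y := by simp [hy.le]
  have t1 := tendsto_log_nhdsWithin_im_neg_of_re_neg_of_im_zero hre him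
  have t2 := (tendsto_log_nhdsWithin_im_nonneg_of_re_neg_of_im_zero hre him).mono_left
    (nhdsWithin_mono _ (fun w (hw : 0 < w.im) => hw.le))
  rw [hn] at t1 t2
  have n1 : (𝓝[{w : ℂ | w.im < 0}] (-y : ℂ)).NeBot := by
    refine mem_closure_iff_nhdsWithin_neBot.1 ?_
    rw [closure_setOfPred_im_lt]; simp
  have n2 : (𝓝[{w : ℂ | 0 < w.im}] (-y : ℂ)).NeBot := by
    refine mem_closure_iff_nhdsWithin_neBot.1 ?_
    rw [closure_setOfPred_lt_im]; simp
  have a1 : Tendsto J (𝓝[{w : ℂ | w.im < 0}] (-y : ℂ)) (𝓝 (q (Real.log y - Real.pi * I))) := by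
    refine ((hq.tendsto _).comp t1).congr' ?_
    filter_upwards [nhdsWithin_le_nhds h, self_mem_nhdsWithin] with w hw hw'
    exact (hw (Or.inr (ne_of_lt hw'))).symm
  have a2 : Tendsto J (𝓝[{w : ℂ | 0 < w.im}] (-y : ℂ)) (𝓝 (q (Real.log y + Real.pi * I))) := by
    refine ((hq.tendsto _).comp t2).congr' ?_
    filter_upwards [nhdsWithin_le_nhds h, self_mem_nhdsWithin] with w hw hw'
    exact (hw (Or.inr (ne_of_gt hw'))).symm
  rw [tendsto_nhds_unique a2 (hJ.tendsto.mono_left nhdsWithin_le_nhds),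
    tendsto_nhds_unique a1 (hJ.tendsto.mono_left nhdsWithin_le_nhds)]

/-! ### Geometry of G and of the slabs. -/

/-- The integrand `e^{-ih/ε} (lam + ∑ₚ vₚ / (s - zₚ))` of `W₊`. -/
def integrand (ε : ℝ) (c z v : Fin P → ℂ) (lam : ℝ) (s : ℂ) : ℂ :=
  exp (-I * h c z lam s / ε) * forcing z v lam s

/-- The part of the upper half-plane strictly between the real parts of the neighbours of `zₘ`. -/
def slab (z : Fin P → ℂ) (m : Fin P) : Set ℂ :=
  {x | 0 < x.im ∧ (∀ p < m, (z p).re < x.re) ∧ ∀ p > m, x.re < (z p).re}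

/-- `e^{-ih/ε}` with the factor that is singular at `zₘ` removed. -/
def regularExp (ε : ℝ) (c z : Fin P → ℂ) (lam : ℝ) (m : Fin P) (s : ℂ) : ℂ :=
  exp (-I * (h c z lam s - c m * log (I * (s - z m))) / ε)

/-- `i (s - zₘ)` times the inhomogeneity, with its removable singularity at `zₘ` filled in. -/
def regularForcing (z v : Fin P → ℂ) (lam : ℝ) (m : Fin P) (s : ℂ) : ℂ :=
  I * (s - z m) * (lam + ∑ p ∈ Finset.univ.erase m, v p / (s - z p)) + I * v m

theorem isOpen_G (z : Fin P → ℂ) : IsOpen (G z) := by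
  have : G z = ⋂ p, ((fun x => I * (x - z p)) ⁻¹' slitPlane ∩
      (fun x => -I * (x - starRingEnd ℂ (z p))) ⁻¹' slitPlane) := by
    ext x; simp [G]
  rw [this]
  refine isOpen_iInter_of_finite fun p => ?_
  exact (isOpen_slitPlane.preimage (by fun_prop)).inter (isOpen_slitPlane.preimage (by fun_prop))

theorem mem_G_iff {z : Fin P → ℂ} {x : ℂ} :
    x ∈ G z ↔ ∀ p, x.re = (z p).re → x.im < (z p).im ∧ -(z p).im < x.im := by
  simp only [G, mem_ofPred_eq, mem_slitPlane_iff]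
  refine forall_congr' fun p => ?_
  simp only [mul_re, I_re, sub_re, zero_mul, I_im, sub_im, one_mul, zero_sub, mul_im, zero_add,
    neg_mul, neg_re, neg_im, conj_re, conj_im, ne_eq]
  constructor
  · rintro ⟨h1, h2⟩ he
    constructor
    · rcases h1 with h1 | h1
      · linarith
      · exact absurd (by linarith) h1
    · rcases h2 with h2 | h2
      · linarith
      · exact absurd (by linarith) h2
  · intro hp
    by_cases he : x.re = (z p).re
    · obtain ⟨h1, h2⟩ := hp he
      exact ⟨Or.inl (by linarith), Or.inl (by linarith)⟩
    · have : x.re - (z p).re ≠ 0 := sub_ne_zero.2 he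
      exact ⟨Or.inr (by simpa using this),
        Or.inr (by simpa [sub_eq_zero, eq_comm] using this)⟩

theorem mem_G_of_re_lt {z : Fin P → ℂ} {x : ℂ} (hx : ∀ p, x.re < (z p).re) : x ∈ G z :=
  mem_G_iff.2 fun p hp => absurd hp (hx p).ne

theorem ofReal_mem_G {z : Fin P → ℂ} (hz : ∀ p, 0 < (z p).im) (x : ℝ) : (x : ℂ) ∈ G z :=
  mem_G_iff.2 fun p _ => by simpa using hz p

theorem vertical_segment_subset_G {z : Fin P → ℂ} (hz : ∀ p, 0 < (z p).im) {w : ℂ} (hw : w ∈ G z) :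
    segment ℝ (w.re : ℂ) w ⊆ G z := by
  rintro _ ⟨a, b, ha, hb, hab, rfl⟩
  refine mem_G_iff.2 fun p hp => ?_
  have hre : w.re = (z p).re := by
    rw [← hp]
    simp only [add_re, smul_re, ofReal_re, smul_eq_mul]
    rw [← add_mul, hab, one_mul]
  obtain ⟨h1, h2⟩ := mem_G_iff.1 hw p hre
  have := hz p
  simp only [add_im, smul_im, ofReal_im, smul_eq_mul, mul_zero, zero_add]
  constructor <;> nlinarith

theorem ne_of_mem_G {z : Fin P → ℂ} {x : ℂ} (hx : x ∈ G z) (p : Fin P) : x ≠ z p := by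
  rintro rfl
  exact lt_irrefl _ (mem_G_iff.1 hx p rfl).1

theorem convex_slab (z : Fin P → ℂ) (m : Fin P) : Convex ℝ (slab z m) := by
  have : slab z m = {x | 0 < x.im} ∩ ((⋂ p, ⋂ (_ : p < m), {x | (z p).re < x.re}) ∩
      ⋂ p, ⋂ (_ : m < p), {x | x.re < (z p).re}) := by
    ext x; simp [slab]
  rw [this]
  refine (convex_halfSpace_im_gt 0).inter (Convex.inter ?_ ?_)
  · exact convex_iInter fun p => convex_iInter fun _ => convex_halfSpace_re_gt _
  · exact convex_iInter fun p => convex_iInter fun _ => convex_halfSpace_re_lt _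

theorem isOpen_slab (z : Fin P → ℂ) (m : Fin P) : IsOpen (slab z m) := by
  have : slab z m = {x | 0 < x.im} ∩ ((⋂ p, ⋂ (_ : p < m), {x | (z p).re < x.re}) ∩
      ⋂ p, ⋂ (_ : m < p), {x | x.re < (z p).re}) := by
    ext x; simp [slab]
  rw [this]
  refine (isOpen_lt continuous_const continuous_im).inter (IsOpen.inter ?_ ?_)
  · exact isOpen_iInter_of_finite fun p => isOpen_iInter_of_finite fun _ =>
      isOpen_lt continuous_const continuous_re
  · exact isOpen_iInter_of_finite fun p => isOpen_iInter_of_finite fun _ =>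
      isOpen_lt continuous_re continuous_const

theorem mem_slab_of_re_eq {z : Fin P → ℂ} (hre : StrictMono fun p => (z p).re) {m : Fin P} {x : ℂ}
    (hx : 0 < x.im) (h : x.re = (z m).re) : x ∈ slab z m :=
  ⟨hx, fun _ hp => h ▸ hre hp, fun _ hp => h ▸ hre hp⟩

theorem re_ne_of_mem_slab {z : Fin P → ℂ} {m p : Fin P} {x : ℂ} (hx : x ∈ slab z m) (hp : p ≠ m) :
    x.re ≠ (z p).re := by
  rcases lt_or_gt_of_ne hp with h | h
  · exact (hx.2.1 p h).ne'
  · exact (hx.2.2 p h).ne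

/-- Among all the cuts only the one above z_m meets the slab: the others have excluded real parts,
and the downward cuts lie in the lower half-plane. -/
theorem mem_G_iff_of_mem_slab {z : Fin P → ℂ} (hz : ∀ p, 0 < (z p).im) {m : Fin P} {x : ℂ}
    (hx : x ∈ slab z m) : x ∈ G z ↔ I * (x - z m) ∈ slitPlane := by
  refine ⟨fun h => (h m).1, fun h => mem_G_iff.2 fun p hp => ?_⟩
  by_cases hpm : p = m
  · subst hpm
    have h1 := hx.1
    have h2 := hz p
    rw [mem_slitPlane_iff] at h
    refine ⟨?_, by linarith⟩
    rcases h with h | h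
    · simp at h; exact h
    · simp [hp] at h
  · exact absurd hp (re_ne_of_mem_slab hx hpm)

open scoped ComplexOrder in
/-- The part of a slab off the branch cut is connected. -/
theorem isPreconnected_slab_inter_G {z : Fin P → ℂ} (hz : ∀ p, 0 < (z p).im)
    (hre : StrictMono fun p => (z p).re) (m : Fin P) : IsPreconnected (slab z m ∩ G z) := by
  have hr : 0 < (z m).im / 2 := half_pos (hz m)
  -- Halfway between the real line and z_m. There u = i(a - z_m) is the positive number Im z_m / 2,
  -- and the slit plane is star-shaped about positive reals.
  set a : ℂ := z m - ((z m).im / 2 : ℝ) * I with ha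
  have haS : a ∈ slab z m := mem_slab_of_re_eq hre (by simp [ha]; linarith [hz m]) (by simp [ha])
  have hstar : StarConvex ℝ a (slab z m ∩ G z) := by
    have e : slab z m ∩ G z = slab z m ∩ (fun x => I * (x - z m)) ⁻¹' slitPlane := by
      ext x
      exact and_congr_right fun hx => mem_G_iff_of_mem_slab hz hx
    rw [e]
    refine ((convex_slab z m).starConvex haS).inter ?_
    intro y hy s t hs ht hst
    have hpos : (0 : ℂ) < (((z m).im / 2 : ℝ) : ℂ) := by exact_mod_cast hr
    have := starConvex_slitPlane hpos (y := I * (y - z m)) hy hs ht hst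
    have e2 : I * (s • a + t • y - z m) =
        s • (((z m).im / 2 : ℝ) : ℂ) + t • (I * (y - z m)) := by
      have hst' : (s : ℂ) + t = 1 := by exact_mod_cast hst
      simp only [ha, real_smul]
      linear_combination (I : ℂ) * z m * hst' - (s : ℂ) * (((z m).im / 2 : ℝ) : ℂ) * I_sq
    change I * (s • a + t • y - z m) ∈ slitPlane
    rw [e2]; exact this
  suffices haG : a ∈ G z from (hstar.isPathConnected ⟨haS, haG⟩).isConnected.isPreconnected
  refine (mem_G_iff_of_mem_slab hz haS).2 ?_
  refine Or.inl ?_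
  simp [ha]
  linarith [hz m]

/-! ### Holomorphy of the integrand and its factorization at z_m. -/

theorem differentiableOn_h (c z : Fin P → ℂ) (lam : ℝ) : DifferentiableOn ℂ (h c z lam) (G z) := by
  unfold h f
  refine DifferentiableOn.add (by fun_prop) ?_
  refine DifferentiableOn.fun_sum fun p _ => ?_
  refine DifferentiableOn.add ?_ ?_
  · refine (DifferentiableOn.add_const _ ?_).const_mul _
    exact DifferentiableOn.clog (by fun_prop) fun x hx => (hx p).1
  · refine DifferentiableOn.const_mul (DifferentiableOn.sub ?_ (differentiableOn_const _)) _
    exact DifferentiableOn.clog (by fun_prop) fun x hx => (hx p).2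

theorem differentiableOn_forcing (z v : Fin P → ℂ) (lam : ℝ) :
    DifferentiableOn ℂ (forcing z v lam) (G z) := by
  unfold forcing
  refine DifferentiableOn.const_add _ (DifferentiableOn.fun_sum fun p _ => ?_)
  exact DifferentiableOn.div (by fun_prop) (by fun_prop)
    fun x hx => sub_ne_zero.2 (ne_of_mem_G hx p)

theorem differentiableOn_integrand (ε : ℝ) (c z v : Fin P → ℂ) (lam : ℝ) :
    DifferentiableOn ℂ (integrand ε c z v lam) (G z) := by
  unfold integrand
  refine DifferentiableOn.mul ?_ (differentiableOn_forcing z v lam)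
  exact (((differentiableOn_h c z lam).const_mul _).div_const _).cexp

theorem log_terms_differentiableOn_slab {z : Fin P → ℂ} {m p : Fin P} (hp : p ≠ m) :
    DifferentiableOn ℂ (fun s => log (I * (s - z p))) (slab z m) := by
  refine DifferentiableOn.clog (by fun_prop) fun x hx => ?_
  have := re_ne_of_mem_slab hx hp
  refine Or.inr ?_
  simpa [sub_eq_zero] using this

theorem conj_log_terms_differentiableOn_slab {z : Fin P → ℂ} (hz : ∀ p, 0 < (z p).im)
    (m p : Fin P) : DifferentiableOn ℂ (fun s => log (-I * (s - starRingEnd ℂ (z p))))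
      (slab z m) := by
  refine DifferentiableOn.clog (by fun_prop) fun x hx => ?_
  have h1 := hx.1
  have h2 := hz p
  refine Or.inl ?_
  simp
  linarith

theorem regularExp_ne_zero (ε : ℝ) (c z : Fin P → ℂ) (lam : ℝ) (m : Fin P) (s : ℂ) :
    regularExp ε c z lam m s ≠ 0 := exp_ne_zero _

/-- Removing c_m log u removes the only logarithm whose cut meets the slab. The domain is the union
with G because the factor is needed both around z_m and along the whole contour from -i∞. -/
theorem differentiableOn_regularExp (ε : ℝ) (c : Fin P → ℂ) {z : Fin P → ℂ}
    (hz : ∀ p, 0 < (z p).im) (lam : ℝ) (m : Fin P) :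
    DifferentiableOn ℂ (regularExp ε c z lam m) (G z ∪ slab z m) := by
  refine DifferentiableOn.union_of_isOpen ?_ ?_ (isOpen_G z) (isOpen_slab z m)
  · unfold regularExp
    refine DifferentiableOn.cexp (((DifferentiableOn.sub (differentiableOn_h c z lam)
      (DifferentiableOn.const_mul ?_ _)).const_mul _).div_const _)
    exact DifferentiableOn.clog (by fun_prop) fun x hx => (hx m).1
  · have e : ∀ s, h c z lam s - c m * log (I * (s - z m)) = lam * s + (c m * (Real.pi * I / 2) +
        ∑ p ∈ Finset.univ.erase m, c p * (log (I * (s - z p)) + Real.pi * I / 2) +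
        ∑ p, starRingEnd ℂ (c p) * (log (-I * (s - starRingEnd ℂ (z p))) - Real.pi * I / 2)) := by
      intro s
      unfold h f
      rw [Finset.sum_add_distrib, ← Finset.add_sum_erase _ _ (Finset.mem_univ m)]
      ring
    unfold regularExp
    simp only [e]
    refine DifferentiableOn.cexp (DifferentiableOn.div_const (DifferentiableOn.const_mul
      (DifferentiableOn.add (by fun_prop) (DifferentiableOn.add (DifferentiableOn.const_add _
        (DifferentiableOn.fun_sum fun p hp => ?_)) (DifferentiableOn.fun_sum fun p _ => ?_))) _) _)
    · exact ((log_terms_differentiableOn_slab (Finset.ne_of_mem_erase hp)).add_const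
        _).const_mul _
    · exact ((conj_log_terms_differentiableOn_slab hz m p).sub_const _).const_mul _

theorem differentiableOn_regularForcing (z v : Fin P → ℂ) (lam : ℝ) (m : Fin P) :
    DifferentiableOn ℂ (regularForcing z v lam m) (G z ∪ slab z m) := by
  unfold regularForcing
  refine DifferentiableOn.add_const _ (DifferentiableOn.mul (by fun_prop)
    (DifferentiableOn.const_add _ (DifferentiableOn.fun_sum fun p hp => ?_)))
  refine DifferentiableOn.div (by fun_prop) (by fun_prop) fun x hx => sub_ne_zero.2 ?_
  rcases hx with hx | hx
  · exact ne_of_mem_G hx p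
  · rintro rfl
    exact re_ne_of_mem_slab hx (Finset.ne_of_mem_erase hp) rfl

theorem exp_eq_regularExp_mul (ε : ℝ) (c z : Fin P → ℂ) (lam : ℝ) {m : Fin P} {s : ℂ}
    (hs : s ≠ z m) : exp (-I * h c z lam s / ε) =
      regularExp ε c z lam m s * (I * (s - z m)) ^ (-(I * c m / ε)) := by
  rw [regularExp, cpow_def_of_ne_zero (mul_ne_zero I_ne_zero (sub_ne_zero.2 hs)), ← exp_add]
  congr 1
  ring

theorem regularForcing_eq (z v : Fin P → ℂ) (lam : ℝ) {m : Fin P} {s : ℂ} (hs : s ≠ z m) :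
    regularForcing z v lam m s = I * (s - z m) * forcing z v lam s := by
  have : s - z m ≠ 0 := sub_ne_zero.2 hs
  rw [regularForcing, forcing, ← Finset.add_sum_erase _ _ (Finset.mem_univ m)]
  field_simp
  ring

theorem HFormula_eq (ε : ℝ) (c z v : Fin P → ℂ) (lam : ℝ) {m : Fin P} {s : ℂ} (hs : s ≠ z m) :
    HFormula ε c z v lam m s = -regularExp ε c z lam m s * regularForcing z v lam m s := by
  have hu : I * (s - z m) ≠ 0 := mul_ne_zero I_ne_zero (sub_ne_zero.2 hs)
  have hp : (I * (s - z m)) ^ (-(I * c m / ε)) ≠ 0 := by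
    simp [cpow_eq_zero_iff, hu, -mul_eq_zero]
  rw [HFormula, exp_eq_regularExp_mul ε c z lam hs, regularForcing_eq z v lam hs,
    cpow_sub _ _ hu, cpow_one]
  field_simp

/-- `Hₘ` is minus the product of the two regularized factors. -/
theorem H_eq (ε : ℝ) (c v : Fin P → ℂ) {z : Fin P → ℂ} (hz : ∀ p, 0 < (z p).im)
    (hre : StrictMono fun p => (z p).re) (lam : ℝ) (m : Fin P) :
    H ε c z v lam m = fun s => -regularExp ε c z lam m s * regularForcing z v lam m s := by
  funext s
  by_cases hs : s = z m
  · subst hs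
    rw [H, Function.update_self]
    refine Tendsto.limUnder_eq ?_
    have hmem : z m ∈ G z ∪ slab z m := Or.inr (mem_slab_of_re_eq hre (hz m) rfl)
    have hd := (((differentiableOn_regularExp ε c hz lam m).neg.mul
      (differentiableOn_regularForcing z v lam m)).continuousOn.continuousAt
      (((isOpen_G z).union (isOpen_slab z m)).mem_nhds hmem))
    refine Tendsto.congr' ?_ (hd.tendsto.mono_left nhdsWithin_le_nhds)
    filter_upwards [self_mem_nhdsWithin] with s hs
    exact (HFormula_eq ε c z v lam hs).symm
  · rw [H, Function.update_of_ne hs, HFormula_eq ε c z v lam hs]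

theorem differentiableOn_H (ε : ℝ) (c v : Fin P → ℂ) {z : Fin P → ℂ} (hz : ∀ p, 0 < (z p).im)
    (hre : StrictMono fun p => (z p).re) (lam : ℝ) (m : Fin P) :
    DifferentiableOn ℂ (H ε c z v lam m) (G z ∪ slab z m) := by
  rw [H_eq ε c v hz hre]
  exact (differentiableOn_regularExp ε c hz lam m).neg.mul
    (differentiableOn_regularForcing z v lam m)

theorem integrand_eq (ε : ℝ) (c v : Fin P → ℂ) {z : Fin P → ℂ} (hz : ∀ p, 0 < (z p).im)
    (hre : StrictMono fun p => (z p).re) (lam : ℝ) {m : Fin P} {s : ℂ} (hs : s ≠ z m) :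
    integrand ε c z v lam s =
      -((I * (s - z m)) ^ (-(I * c m / ε) - 1) * H ε c z v lam m s) := by
  have hu : I * (s - z m) ≠ 0 := mul_ne_zero I_ne_zero (sub_ne_zero.2 hs)
  rw [H_eq ε c v hz hre, integrand, exp_eq_regularExp_mul ε c z lam hs]
  simp only
  rw [regularForcing_eq z v lam hs, cpow_sub _ _ hu, cpow_one]
  field_simp

/-! ### Exponential decay near -i∞. -/

/-- `F` is holomorphic in a lower half-plane and is bounded there by a polynomial times
`e^{κ Im w}`. -/
def ExpDecay (κ : ℝ) (F : ℂ → ℂ) : Prop :=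
  ∃ (R C : ℝ) (M : ℕ), 0 ≤ C ∧ DifferentiableOn ℂ F {w | w.im < -R} ∧
    ∀ w : ℂ, w.im < -R → ‖F w‖ ≤ C * (1 + ‖w‖) ^ M * Real.exp (κ * w.im)

theorem ExpDecay.mul {κ₁ κ₂ : ℝ} {F₁ F₂ : ℂ → ℂ} (h₁ : ExpDecay κ₁ F₁) (h₂ : ExpDecay κ₂ F₂) :
    ExpDecay (κ₁ + κ₂) (fun s => F₁ s * F₂ s) := by
  obtain ⟨R₁, C₁, M₁, hC₁, hd₁, hb₁⟩ := h₁
  obtain ⟨R₂, C₂, M₂, hC₂, hd₂, hb₂⟩ := h₂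
  refine ⟨max R₁ R₂, C₁ * C₂, M₁ + M₂, by positivity, ?_, ?_⟩
  · refine (hd₁.mono fun w hw => ?_).mul (hd₂.mono fun w hw => ?_)
    · exact lt_of_lt_of_le (mem_ofPred_eq ▸ hw) (neg_le_neg (le_max_left _ _))
    · exact lt_of_lt_of_le (mem_ofPred_eq ▸ hw) (neg_le_neg (le_max_right _ _))
  · intro w hw
    have b₁ := hb₁ w (hw.trans_le (neg_le_neg (le_max_left _ _)))
    have b₂ := hb₂ w (hw.trans_le (neg_le_neg (le_max_right _ _)))
    calc ‖F₁ w * F₂ w‖ ≤ (C₁ * (1 + ‖w‖) ^ M₁ * Real.exp (κ₁ * w.im)) *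
          (C₂ * (1 + ‖w‖) ^ M₂ * Real.exp (κ₂ * w.im)) := by
          rw [norm_mul]; gcongr
      _ = _ := by rw [pow_add, add_mul, Real.exp_add]; ring

theorem ExpDecay.add {κ : ℝ} {F₁ F₂ : ℂ → ℂ} (h₁ : ExpDecay κ F₁) (h₂ : ExpDecay κ F₂) :
    ExpDecay κ (fun s => F₁ s + F₂ s) := by
  obtain ⟨R₁, C₁, M₁, hC₁, hd₁, hb₁⟩ := h₁
  obtain ⟨R₂, C₂, M₂, hC₂, hd₂, hb₂⟩ := h₂
  refine ⟨max R₁ R₂, C₁ + C₂, M₁ + M₂, by positivity, ?_, ?_⟩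
  · refine (hd₁.mono fun w hw => ?_).add (hd₂.mono fun w hw => ?_)
    · exact lt_of_lt_of_le (mem_ofPred_eq ▸ hw) (neg_le_neg (le_max_left _ _))
    · exact lt_of_lt_of_le (mem_ofPred_eq ▸ hw) (neg_le_neg (le_max_right _ _))
  · intro w hw
    have b₁ := hb₁ w (hw.trans_le (neg_le_neg (le_max_left _ _)))
    have b₂ := hb₂ w (hw.trans_le (neg_le_neg (le_max_right _ _)))
    have hw1 : 1 ≤ 1 + ‖w‖ := by linarith [norm_nonneg w]
    calc ‖F₁ w + F₂ w‖ ≤ C₁ * (1 + ‖w‖) ^ M₁ * Real.exp (κ * w.im) +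
          C₂ * (1 + ‖w‖) ^ M₂ * Real.exp (κ * w.im) := (norm_add_le _ _).trans (add_le_add b₁ b₂)
      _ ≤ C₁ * (1 + ‖w‖) ^ (M₁ + M₂) * Real.exp (κ * w.im) +
          C₂ * (1 + ‖w‖) ^ (M₁ + M₂) * Real.exp (κ * w.im) := by
          gcongr <;> first | exact hw1 | omega
      _ = _ := by ring

theorem expDecay_const (a : ℂ) : ExpDecay 0 (fun _ => a) :=
  ⟨0, ‖a‖, 0, norm_nonneg _, differentiableOn_const _, fun w _ => by simp⟩

theorem expDecay_sum {ι : Type*} (s : Finset ι) {F : ι → ℂ → ℂ} (hF : ∀ i ∈ s, ExpDecay 0 (F i)) :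
    ExpDecay 0 (fun w => ∑ i ∈ s, F i w) := by
  classical
  induction s using Finset.induction_on with
  | empty => simpa using expDecay_const 0
  | insert i s hi ih =>
    simp only [Finset.sum_insert hi]
    exact (hF i (Finset.mem_insert_self _ _)).add
      (ih fun j hj => hF j (Finset.mem_insert_of_mem hj))

theorem expDecay_prod {ι : Type*} (s : Finset ι) {F : ι → ℂ → ℂ} (hF : ∀ i ∈ s, ExpDecay 0 (F i)) :
    ExpDecay 0 (fun w => ∏ i ∈ s, F i w) := by
  classical
  induction s using Finset.induction_on with
  | empty => simpa using expDecay_const 1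
  | insert i s hi ih =>
    simp only [Finset.prod_insert hi]
    simpa using (hF i (Finset.mem_insert_self _ _)).mul
      (ih fun j hj => hF j (Finset.mem_insert_of_mem hj))

theorem re_I_mul_sub_gt {s w : ℂ} (hs : s.im < -(1 + ‖w‖)) : 1 < (I * (s - w)).re := by
  have := neg_le_of_abs_le (abs_im_le_norm w)
  simp
  linarith

theorem expDecay_inv_sub (w : ℂ) : ExpDecay 0 (fun s => 1 / (s - w)) := by
  have key : ∀ s : ℂ, s.im < -(1 + ‖w‖) → 1 ≤ ‖s - w‖ := by
    intro s hs
    have := (re_I_mul_sub_gt hs).le.trans (re_le_norm _)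
    simpa using this
  refine ⟨1 + ‖w‖, 1, 0, zero_le_one, ?_, fun s hs => ?_⟩
  · refine DifferentiableOn.div (by fun_prop) (by fun_prop) fun s hs h0 => ?_
    have := key s hs
    rw [h0, norm_zero] at this
    linarith
  · have := key s hs
    simp only [norm_div, norm_one, pow_zero, mul_one, zero_mul, Real.exp_zero]
    rw [div_le_one (by linarith)]
    exact this

/-- Since |log u| ≤ log|u| + π when |u| ≥ 1, the exponential of a log u grows at most like the power
|u|^{|a|}, up to a constant. -/
theorem expDecay_exp_log (a b w : ℂ) :
    ExpDecay 0 (fun s => exp (a * log (I * (s - w)) + b)) := by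
  obtain ⟨N, hN⟩ := exists_nat_ge ‖a‖
  refine ⟨1 + ‖w‖, (1 + ‖w‖) ^ N * Real.exp (‖a‖ * Real.pi + ‖b‖), N, by positivity, ?_,
    fun s hs => ?_⟩
  · refine DifferentiableOn.cexp (DifferentiableOn.add_const _ (DifferentiableOn.const_mul
      (DifferentiableOn.clog (by fun_prop) fun s hs => Or.inl ?_) _))
    exact zero_lt_one.trans (re_I_mul_sub_gt hs)
  · have h1 : 1 ≤ ‖s - w‖ := by
      simpa using (re_I_mul_sub_gt hs).le.trans (re_le_norm _)
    have h2 : ‖s - w‖ ≤ (1 + ‖w‖) * (1 + ‖s‖) := by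
      have := norm_sub_le s w
      nlinarith [norm_nonneg s, norm_nonneg w]
    have h3 : ‖log (I * (s - w))‖ ≤ Real.log ((1 + ‖w‖) * (1 + ‖s‖)) + Real.pi := by
      refine (norm_le_abs_re_add_abs_im _).trans (add_le_add ?_ ?_)
      · rw [log_re, norm_mul, norm_I, one_mul, abs_of_nonneg (Real.log_nonneg h1)]
        exact Real.log_le_log (by linarith) h2
      · rw [log_im]; exact abs_arg_le_pi _
    have h4 : 1 ≤ (1 + ‖w‖) * (1 + ‖s‖) := h1.trans h2
    have h5 : 0 ≤ Real.log ((1 + ‖w‖) * (1 + ‖s‖)) := Real.log_nonneg h4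
    rw [norm_exp, zero_mul, Real.exp_zero, mul_one]
    calc Real.exp (a * log (I * (s - w)) + b).re
        ≤ Real.exp (N * Real.log ((1 + ‖w‖) * (1 + ‖s‖)) + (‖a‖ * Real.pi + ‖b‖)) := by
          refine Real.exp_le_exp.2 ((re_le_norm _).trans ((norm_add_le _ _).trans ?_))
          rw [norm_mul]
          have : ‖a‖ * ‖log (I * (s - w))‖ ≤
              ‖a‖ * (Real.log ((1 + ‖w‖) * (1 + ‖s‖)) + Real.pi) := by gcongr
          nlinarith
      _ = _ := by
          rw [Real.exp_add, Real.exp_nat_mul, Real.exp_log (by linarith), mul_pow]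
          ring

/-- Cauchy's estimate on unit circles: moving by distance 1 costs only the factors 2^M and e^{|κ|}.
-/
theorem ExpDecay.deriv {κ : ℝ} {F : ℂ → ℂ} (hF : ExpDecay κ F) : ExpDecay κ (deriv F) := by
  obtain ⟨R, C, M, hC, hd, hb⟩ := hF
  have hopen : IsOpen {w : ℂ | w.im < -R} := isOpen_lt continuous_im continuous_const
  refine ⟨R + 1, C * 2 ^ M * Real.exp |κ|, M, by positivity, ?_, fun w hw => ?_⟩
  · exact (hd.deriv hopen).mono fun w hw => lt_trans (mem_ofPred_eq ▸ hw) (by linarith)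
  · have hsub : Metric.closedBall w 1 ⊆ {w : ℂ | w.im < -R} := by
      intro s hs
      have h1 : |(s - w).im| ≤ 1 := (abs_im_le_norm _).trans (by simpa [dist_eq] using hs)
      have h2 := (abs_le.1 h1).2
      simp only [sub_im] at h2
      change s.im < -R
      linarith
    have hdc : DiffContOnCl ℂ F (Metric.ball w 1) := by
      refine DifferentiableOn.diffContOnCl (hd.mono ?_)
      rw [closure_ball w one_ne_zero]
      exact hsub
    refine (norm_deriv_le_of_forall_mem_sphere_norm_le (C := C * 2 ^ M * Real.exp |κ| *
      (1 + ‖w‖) ^ M * Real.exp (κ * w.im)) one_pos hdc fun s hs => ?_).trans (by rw [div_one])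
    have hs' := Metric.sphere_subset_closedBall hs
    have h0 : ‖s - w‖ = 1 := by simpa [dist_eq] using hs
    have h1 : ‖s‖ ≤ ‖w‖ + 1 := by
      have := norm_add_le w (s - w)
      rw [add_sub_cancel, h0] at this
      exact this
    have h2 : κ * s.im ≤ |κ| + κ * w.im := by
      have h3 : |(s - w).im| ≤ 1 := (abs_im_le_norm _).trans h0.le
      have h4 : κ * (s - w).im ≤ |κ| := by
        refine (le_abs_self _).trans ?_
        rw [abs_mul]
        nlinarith [abs_nonneg κ]
      simp only [sub_im] at h4
      linarith
    calc ‖F s‖ ≤ C * (1 + ‖s‖) ^ M * Real.exp (κ * s.im) := hb s (hsub hs')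
      _ ≤ C * (2 * (1 + ‖w‖)) ^ M * Real.exp (|κ| + κ * w.im) := by
          gcongr
          linarith [norm_nonneg w]
      _ = _ := by rw [mul_pow, Real.exp_add]; ring

/-- Near `-i∞` in the half-plane to the left of all `zₚ`, the function `F` coincides with a function
that decays like `e^{κ Im w}` in a whole lower half-plane. -/
def LeftDecay (κ : ℝ) (z : Fin P → ℂ) (F : ℂ → ℂ) : Prop :=
  ∃ E : ℂ → ℂ, ExpDecay κ E ∧ ∃ R : ℝ, ∀ s : ℂ, (∀ p, s.re < (z p).re) → s.im < -R → F s = E s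

theorem LeftDecay.mul {κ₁ κ₂ : ℝ} {z : Fin P → ℂ} {F₁ F₂ : ℂ → ℂ} (h₁ : LeftDecay κ₁ z F₁)
    (h₂ : LeftDecay κ₂ z F₂) : LeftDecay (κ₁ + κ₂) z (fun s => F₁ s * F₂ s) := by
  obtain ⟨E₁, hE₁, R₁, e₁⟩ := h₁
  obtain ⟨E₂, hE₂, R₂, e₂⟩ := h₂
  refine ⟨_, hE₁.mul hE₂, max R₁ R₂, fun s hs hs' => ?_⟩
  simp only
  rw [e₁ s hs (hs'.trans_le (neg_le_neg (le_max_left _ _))),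
    e₂ s hs (hs'.trans_le (neg_le_neg (le_max_right _ _)))]

theorem LeftDecay.deriv {κ : ℝ} {z : Fin P → ℂ} {F : ℂ → ℂ} (hF : LeftDecay κ z F) :
    LeftDecay κ z (deriv F) := by
  obtain ⟨E, hE, R, e⟩ := hF
  refine ⟨_, hE.deriv, R, fun s hs hs' => Filter.EventuallyEq.deriv_eq ?_⟩
  have h1 : ∀ᶠ w : ℂ in 𝓝 s, ∀ p, w.re < (z p).re :=
    eventually_all.2 fun p => continuous_re.continuousAt.eventually_lt_const (hs p)
  filter_upwards [h1, continuous_im.continuousAt.eventually_lt_const hs'] with w hw hw'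
  exact e w hw hw'

theorem LeftDecay.iteratedDeriv {κ : ℝ} {z : Fin P → ℂ} {F : ℂ → ℂ} (hF : LeftDecay κ z F) (n : ℕ) :
    LeftDecay κ z (iteratedDeriv n F) := by
  induction n with
  | zero => simpa using hF
  | succ n ih => rw [iteratedDeriv_succ]; exact ih.deriv

theorem leftDecay_cpow (z : Fin P → ℂ) (a w : ℂ) :
    LeftDecay 0 z (fun s => (I * (s - w)) ^ a) := by
  refine ⟨_, expDecay_exp_log a 0 w, 1 + ‖w‖, fun s _ hs => ?_⟩
  have h1 : I * (s - w) ≠ 0 := by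
    intro h0
    have := re_I_mul_sub_gt hs
    rw [h0] at this
    simp at this
    linarith
  simp only
  rw [cpow_def_of_ne_zero h1, add_zero, mul_comm]

/-- This trades the logarithm with a downward cut for one with an upward cut. To the left of all z_p
the integrand thus continues to a whole lower half-plane, where Cauchy estimates are uniform. -/
theorem log_neg_I_mul_eq {y : ℂ} (hy : y.re < 0) : log (-I * y) = log (I * y) + Real.pi * I := by
  have him : (I * y).im < 0 := by simpa using hy
  have hneg : -I * y = -(I * y) := by ring
  rw [log, log, hneg, norm_neg, arg_neg_eq_arg_add_pi_of_im_neg him]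
  push_cast
  ring

/-- The decay comes from |e^{-iλs/ε}| = e^{(λ/ε) Im s}; the logarithmic factors and the forcing are
polynomially bounded. -/
theorem leftDecay_integrand (ε : ℝ) (c z v : Fin P → ℂ) (lam : ℝ) :
    LeftDecay (lam / ε) z (integrand ε c z v lam) := by
  have h1 : ExpDecay (lam / ε) (fun s => exp (-I * (lam * s) / ε)) := by
    refine ⟨0, 1, 0, zero_le_one, by fun_prop, fun w _ => ?_⟩
    rw [norm_exp]
    have : -I * (lam * w) / ε = ((lam / ε : ℝ) : ℂ) * (-I * w) := by push_cast; ring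
    rw [this, re_ofReal_mul]
    simp
  have h2 : ExpDecay 0 (fun s => ∏ p,
      exp (-I * c p / ε * log (I * (s - z p)) + -I * c p / ε * (Real.pi * I / 2)) *
      exp (-I * starRingEnd ℂ (c p) / ε * log (I * (s - starRingEnd ℂ (z p))) +
        -I * starRingEnd ℂ (c p) / ε * (Real.pi * I / 2))) := by
    refine expDecay_prod _ fun p _ => ?_
    simpa using (expDecay_exp_log _ _ (z p)).mul (expDecay_exp_log _ _ (starRingEnd ℂ (z p)))
  have h3 : ExpDecay 0 (forcing z v lam) := by
    unfold forcing
    refine (expDecay_const _).add (expDecay_sum _ fun p _ => ?_)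
    simpa [div_eq_mul_inv] using (expDecay_const (v p)).mul (expDecay_inv_sub (z p))
  have h4 := (h1.mul h2).mul h3
  rw [add_zero, add_zero] at h4
  refine ⟨_, h4, 0, fun s hs _ => ?_⟩
  rw [integrand]
  congr 1
  simp only [← exp_add]
  rw [← exp_sum, ← exp_add]
  congr 1
  rw [h, f, mul_add, add_div, Finset.mul_sum, Finset.sum_div]
  congr 1
  refine Finset.sum_congr rfl fun p _ => ?_
  rw [log_neg_I_mul_eq (by simpa using hs p)]
  ring

theorem leftDecay_H (ε : ℝ) (c z v : Fin P → ℂ) (lam : ℝ) (m : Fin P) :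
    LeftDecay (lam / ε) z (H ε c z v lam m) := by
  have h1 : LeftDecay 0 z (fun _ => (-1 : ℂ)) := ⟨_, expDecay_const _, 0, fun _ _ _ => rfl⟩
  have h2 := h1.mul ((leftDecay_integrand ε c z v lam).mul
    (leftDecay_cpow z (-(-(I * c m / ε) - 1)) (z m)))
  rw [zero_add, add_zero] at h2
  obtain ⟨E, hE, R, e⟩ := h2
  refine ⟨E, hE, R, fun s hs hs' => ?_⟩
  rw [← e s hs hs']
  simp only [integrand]
  rw [H, Function.update_of_ne (ne_of_mem_G (mem_G_of_re_lt hs) m), HFormula,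
    cpow_neg]
  ring

/-- A decaying function is exponentially small on curves that move down linearly and stay within
linear growth. -/
theorem LeftDecay.eventually_norm_le {κ : ℝ} (hκ : 0 < κ) {z : Fin P → ℂ} {F : ℂ → ℂ}
    (hF : LeftDecay κ z F) {a : ℝ} (ha : 0 < a) (B : ℝ) :
    ∃ C : ℝ, ∀ᶠ t : ℝ in atBot, ∀ w : ℂ, (∀ p, w.re < (z p).re) → w.im ≤ a * t →
      ‖w‖ ≤ B * (1 + |t|) → ‖F w‖ ≤ C * Real.exp (κ * a / 2 * t) := by
  obtain ⟨E, ⟨R, C, M, hC, -, hb⟩, R', e⟩ := hF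
  -- Half of the available rate κa: the other half absorbs the polynomial factor.
  set δ := κ * a / 2 with hδ
  have hδ0 : 0 < δ := by positivity
  set K : ℝ := 1 + 2 * |B| with hK
  have hlim : Tendsto (fun t : ℝ => (K / δ) ^ M * ((δ * -t) ^ M * Real.exp (-(δ * -t)))) atBot
      (𝓝 ((K / δ) ^ M * 0)) := by
    refine Tendsto.const_mul _ ((Real.tendsto_pow_mul_exp_neg_atTop_nhds_zero M).comp ?_)
    exact tendsto_neg_atBot_atTop.const_mul_atTop hδ0
  rw [mul_zero] at hlim
  refine ⟨C, ?_⟩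
  filter_upwards [hlim.eventually_le_const one_pos, eventually_le_atBot (-1),
    eventually_lt_atBot (-R / a), eventually_lt_atBot (-R' / a)]
    with t ht1 ht2 ht3 ht4 w hw1 hw2 hw3
  rw [lt_div_iff₀ ha, mul_comm] at ht3 ht4
  have habs : |t| = -t := abs_of_nonpos (by linarith)
  rw [e w hw1 (hw2.trans_lt ht4)]
  have h1 : 1 + ‖w‖ ≤ K * -t := by
    rw [habs] at hw3
    have : B * (1 + -t) ≤ |B| * (1 + -t) := mul_le_mul_of_nonneg_right (le_abs_self B) (by linarith)
    nlinarith [abs_nonneg B]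
  calc ‖E w‖ ≤ C * (1 + ‖w‖) ^ M * Real.exp (κ * w.im) := hb w (hw2.trans_lt ht3)
    _ ≤ C * (K * -t) ^ M * Real.exp (δ * t + δ * t) := by
        have h2 := mul_le_mul_of_nonneg_left hw2 hκ.le
        have h3 : κ * w.im ≤ δ * t + δ * t := by rw [hδ]; linarith
        have h4 : 0 ≤ K * -t := by linarith [norm_nonneg w]
        gcongr
    _ = C * ((K / δ) ^ M * ((δ * -t) ^ M * Real.exp (-(δ * -t)))) * Real.exp (δ * t) := by
        have e1 : -(δ * -t) = δ * t := by ring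
        have e2 : K * -t = K / δ * (δ * -t) := by field_simp
        rw [Real.exp_add, e1, e2, mul_pow]
        ring
    _ ≤ C * 1 * Real.exp (δ * t) := by gcongr
    _ = C * Real.exp (δ * t) := by rw [mul_one]

/-! ### Integration along the contours ℓ₀. -/

namespace IsEllZero

variable {z : Fin P → ℂ} {γ : ℝ → ℂ} {x : ℂ}

theorem exists_ae_norm_deriv_le (hγ : IsEllZero z γ x) :
    ∃ C : ℝ, 0 ≤ C ∧ ∀ᵐ t : ℝ, t ≤ 0 → ‖deriv γ t‖ ≤ C := by
  obtain ⟨S, C, hS⟩ := hγ.piecewise_C1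
  refine ⟨max C 0, le_max_right _ _, ?_⟩
  have h1 : ∀ᵐ t : ℝ, t ∉ (insert 0 S : Finset ℝ) :=
    measure_eq_zero_iff_ae_notMem.1 ((insert 0 S : Finset ℝ).measure_zero volume)
  filter_upwards [h1] with t ht h0
  rw [Finset.mem_insert, not_or] at ht
  exact (hS t (lt_of_le_of_ne h0 ht.1) ht.2).2.trans (le_max_left _ _)

theorem hasDerivAt_comp (hγ : IsEllZero z γ x) {φ Φ : ℂ → ℂ}
    (hΦ : ∀ w ∈ G z, HasDerivAt Φ (φ w) w) :
    ∃ S : Finset ℝ, ∀ t < 0, t ∉ S → HasDerivAt (fun t => Φ (γ t)) (φ (γ t) * deriv γ t) t := by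
  obtain ⟨S, C, hS⟩ := hγ.piecewise_C1
  refine ⟨S, fun t ht htS => ?_⟩
  exact (hΦ _ (hγ.mem_G t ht)).comp t
    ((hS t ht htS).1.differentiableAt one_ne_zero).hasDerivAt

/-- Bounded speed gives linear growth; the finitely many exceptional parameters do not affect the
fundamental theorem of calculus. -/
theorem exists_norm_le (hγ : IsEllZero z γ x) : ∃ B : ℝ, ∀ t ≤ 0, ‖γ t‖ ≤ B * (1 + |t|) := by
  obtain ⟨C, hC, hae⟩ := hγ.exists_ae_norm_deriv_le
  obtain ⟨S, C', hS⟩ := hγ.piecewise_C1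
  refine ⟨max ‖γ 0‖ C, fun t ht => ?_⟩
  have hbound : ∀ᵐ s : ℝ, s ∈ uIoc t 0 → ‖deriv γ s‖ ≤ C := by
    filter_upwards [hae] with s hs hst
    rw [uIoc_of_le ht] at hst
    exact hs hst.2
  have hint : IntervalIntegrable (deriv γ) volume t 0 := by
    rw [intervalIntegrable_iff]
    refine Measure.integrableOn_of_bounded (M := C) (by simp)
      (stronglyMeasurable_deriv γ).aestronglyMeasurable ?_
    rwa [ae_restrict_iff' measurableSet_uIoc]
  have h1 := integral_eq_of_hasDerivAt_off_countable_of_le γ (deriv γ) ht (s := (S : Set ℝ))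
    S.countable_toSet (hγ.continuousOn.mono Icc_subset_Iic_self)
    (fun s hs => ((hS s hs.1.2 hs.2).1.differentiableAt one_ne_zero).hasDerivAt) hint
  have h2 := intervalIntegral.norm_integral_le_of_norm_le_const_ae hbound
  rw [h1, zero_sub, abs_neg] at h2
  have h3 : ‖γ t‖ ≤ ‖γ 0‖ + ‖γ 0 - γ t‖ := by
    have := norm_sub_le (γ 0) (γ 0 - γ t)
    rwa [sub_sub_cancel] at this
  calc ‖γ t‖ ≤ ‖γ 0‖ * 1 + C * |t| := by linarith
    _ ≤ max ‖γ 0‖ C * 1 + max ‖γ 0‖ C * |t| := by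
      gcongr
      · exact le_max_left _ _
      · exact le_max_right _ _
    _ = _ := by ring

theorem continuousOn_comp (hγ : IsEllZero z γ x) {φ : ℂ → ℂ} (hφ : ContinuousOn φ (G z)) :
    ContinuousOn (fun t => φ (γ t)) (Iio 0) :=
  hφ.comp (hγ.continuousOn.mono Iio_subset_Iic_self) fun t ht => hγ.mem_G t ht

/-- The half-line splits into an exponentially small tail, a compact middle piece, and an end piece
dominated by an integrable power |t|^e with e > -1. -/
theorem integrableOn (hγ : IsEllZero z γ x) {φ : ℂ → ℂ} (hφ : ContinuousOn φ (G z))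
    (hdecay : ∃ C δ : ℝ, 0 < δ ∧ ∀ᶠ t in atBot, ‖φ (γ t)‖ ≤ C * Real.exp (δ * t))
    (hend : ∃ C e : ℝ, -1 < e ∧ ∀ᶠ t in 𝓝[<] (0 : ℝ), ‖φ (γ t)‖ ≤ C * |t| ^ e) :
    IntegrableOn (fun t => φ (γ t) * deriv γ t) (Iic 0) := by
  obtain ⟨D, hD, hae⟩ := hγ.exists_ae_norm_deriv_le
  have hcont := hγ.continuousOn_comp hφ
  have hmeas : AEStronglyMeasurable (fun t => φ (γ t) * deriv γ t) (volume.restrict (Iic 0)) := by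
    rw [← restrict_Iio_eq_restrict_Iic]
    exact (hcont.aestronglyMeasurable measurableSet_Iio).mul
      (stronglyMeasurable_deriv γ).aestronglyMeasurable
  have key : ∀ (s : Set ℝ) (b : ℝ → ℝ), MeasurableSet s → s ⊆ Iic 0 → IntegrableOn b s →
      (∀ t ∈ s, ‖φ (γ t)‖ ≤ b t) → IntegrableOn (fun t => φ (γ t) * deriv γ t) s := by
    intro s b hs hs0 hb hle
    refine Integrable.mono' (hb.mul_const D) (hmeas.mono_set hs0) ?_
    rw [ae_restrict_iff' hs]
    filter_upwards [hae] with t ht hts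
    rw [norm_mul]
    have := hle t hts
    exact mul_le_mul this (ht (hs0 hts)) (norm_nonneg _) ((norm_nonneg _).trans this)
  obtain ⟨C₁, δ, hδ, h1⟩ := hdecay
  obtain ⟨C₂, e, he, h2⟩ := hend
  obtain ⟨T, hT⟩ := eventually_atBot.1 h1
  obtain ⟨b, hb, hb2⟩ := mem_nhdsLT_iff_exists_Ioo_subset.1 h2
  rw [mem_Iio] at hb
  have hTb : min T b < 0 := (min_le_right _ _).trans_lt hb
  have i1 : IntegrableOn (fun t => φ (γ t) * deriv γ t) (Iic (min T b)) :=
    key _ _ measurableSet_Iic (Iic_subset_Iic.2 hTb.le)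
      ((integrableOn_exp_mul_Iic hδ _).const_mul C₁)
      fun t ht => hT t (ht.trans (min_le_left _ _))
  have i2 : IntegrableOn (fun t => φ (γ t) * deriv γ t) (Icc (min T b) b) := by
    obtain ⟨M, hM⟩ := isCompact_Icc.exists_bound_of_continuousOn
      (hcont.mono (fun t (ht : t ∈ Icc (min T b) b) => ht.2.trans_lt hb))
    exact key _ (fun _ => M) measurableSet_Icc (fun t ht => ht.2.trans hb.le) (by simp) hM
  have i3 : IntegrableOn (fun t => φ (γ t) * deriv γ t) (Ioo b 0) := by
    refine key _ (fun t => C₂ * |t| ^ e) measurableSet_Ioo (fun t ht => ht.2.le) ?_ hb2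
    have h3 : IntervalIntegrable (fun t : ℝ => (-t) ^ e) volume b 0 := by
      refine (IntervalIntegrable.iff_comp_neg).2 ?_
      simpa using intervalIntegral.intervalIntegrable_rpow' (a := -b) (b := 0) he
    rw [intervalIntegrable_iff_integrableOn_Ioo_of_le hb.le] at h3
    refine IntegrableOn.congr_fun (h3.const_mul C₂) (fun t ht => ?_) measurableSet_Ioo
    rw [abs_of_neg ht.2]
  have hun : Iic (0 : ℝ) = (Iic (min T b) ∪ Icc (min T b) b ∪ Ioo b 0) ∪ {0} := by
    ext t
    simp only [mem_Iic, mem_union, mem_Icc, mem_Ioo, mem_singleton_iff]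
    constructor
    · intro ht
      rcases le_or_gt t (min T b) with h | h
      · exact Or.inl (Or.inl (Or.inl h))
      · rcases le_or_gt t b with h' | h'
        · exact Or.inl (Or.inl (Or.inr ⟨h.le, h'⟩))
        · rcases ht.lt_or_eq with h'' | h''
          · exact Or.inl (Or.inr ⟨h', h''⟩)
          · exact Or.inr h''
    · rintro (((h | h) | h) | h)
      · exact h.trans hTb.le
      · exact h.2.trans hb.le
      · exact h.2.le
      · exact h.le
  rw [hun]
  exact ((i1.union i2).union i3).union
    (integrableOn_singleton (hx := by rw [Real.volume_singleton]; exact ENNReal.zero_lt_top))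

/-- The fundamental theorem of calculus along a contour that comes in from `-i∞`. -/
theorem tendsto_atBot_of_primitive (hγ : IsEllZero z γ x) {φ Φ : ℂ → ℂ}
    (hφ : ContinuousOn φ (G z)) (hΦ : ∀ w ∈ G z, HasDerivAt Φ (φ w) w)
    (hdecay : ∃ C δ : ℝ, 0 < δ ∧ ∀ᶠ t in atBot, ‖φ (γ t)‖ ≤ C * Real.exp (δ * t))
    (hend : ∃ C e : ℝ, -1 < e ∧ ∀ᶠ t in 𝓝[<] (0 : ℝ), ‖φ (γ t)‖ ≤ C * |t| ^ e)
    {L : ℂ} (hL : Tendsto (fun t => Φ (γ t)) (𝓝[<] 0) (𝓝 L)) :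
    Tendsto (fun t => Φ (γ t)) atBot (𝓝 (L - contourIntegral γ φ)) := by
  have hint := hγ.integrableOn hφ hdecay hend
  obtain ⟨S, hS⟩ := hγ.hasDerivAt_comp hΦ
  have hlim := intervalIntegral_tendsto_integral_Iic 0 hint (tendsto_id (α := ℝ) (x := atBot))
  refine (tendsto_const_nhds.sub hlim).congr' ?_
  filter_upwards [eventually_lt_atBot 0] with s hs
  -- The end point may be the branch point z_m, outside G, where the value of Φ carries no
  -- information; it is replaced by the limit L.
  set ψ : ℝ → ℂ := Function.update (fun t => Φ (γ t)) 0 L with hψ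
  have hψs : ψ s = Φ (γ s) := Function.update_of_ne hs.ne _ _
  have hψ0 : ψ 0 = L := Function.update_self _ _ _
  have hΦc : ContinuousOn (fun t => Φ (γ t)) (Iio 0) :=
    hγ.continuousOn_comp fun w hw => (hΦ w hw).continuousAt.continuousWithinAt
  have hcont : ContinuousOn ψ (Icc s 0) := by
    intro t ht
    rcases ht.2.lt_or_eq with h | h
    · refine (ContinuousAt.congr ((hΦc t h).continuousAt (Iio_mem_nhds h)) ?_).continuousWithinAt
      filter_upwards [Iio_mem_nhds h] with r hr
      exact (Function.update_of_ne (mem_Iio.1 hr).ne L (fun t => Φ (γ t))).symm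
    · subst h
      rw [hψ, continuousWithinAt_update_same]
      refine hL.mono_left (nhdsWithin_mono _ fun r hr => ?_)
      exact lt_of_le_of_ne hr.1.2 hr.2
  have hder : ∀ t ∈ Ioo s 0 \ (S : Set ℝ), HasDerivAt ψ (φ (γ t) * deriv γ t) t := by
    intro t ht
    refine (hS t ht.1.2 ht.2).congr_of_eventuallyEq ?_
    filter_upwards [Iio_mem_nhds ht.1.2] with r hr
    exact Function.update_of_ne (mem_Iio.1 hr).ne _ _
  have := integral_eq_of_hasDerivAt_off_countable_of_le ψ _ hs.le S.countable_toSet hcont hder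
    ((intervalIntegrable_iff_integrableOn_Ioc_of_le hs.le).2 (hint.mono_set Ioc_subset_Iic_self))
  rw [hψs, hψ0] at this
  simp only [id]
  rw [this, sub_sub_cancel]

theorem exists_exp_bound (hγ : IsEllZero z γ x) {κ : ℝ} (hκ : 0 < κ) {F : ℂ → ℂ}
    (hF : LeftDecay κ z F) :
    ∃ C δ : ℝ, 0 < δ ∧ ∀ᶠ t in atBot, ‖F (γ t)‖ ≤ C * Real.exp (δ * t) := by
  obtain ⟨a, ha, him⟩ := hγ.origin_im
  obtain ⟨B, hB⟩ := hγ.exists_norm_le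
  obtain ⟨C, hC⟩ := hF.eventually_norm_le hκ ha B
  refine ⟨C, κ * a / 2, by positivity, ?_⟩
  filter_upwards [hC, him, hγ.origin_re, eventually_le_atBot 0] with t h1 h2 h3 h4
  exact h1 _ h3 h2 (hB t h4)

theorem tendsto_zero (hγ : IsEllZero z γ x) {κ : ℝ} (hκ : 0 < κ) {F : ℂ → ℂ}
    (hF : LeftDecay κ z F) : Tendsto (fun t => F (γ t)) atBot (𝓝 0) := by
  obtain ⟨C, δ, hδ, hb⟩ := hγ.exists_exp_bound hκ hF
  refine squeeze_zero_norm' hb ?_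
  have h1 : Tendsto (fun t : ℝ => Real.exp (δ * t)) atBot (𝓝 0) :=
    Real.tendsto_exp_atBot.comp (tendsto_id.const_mul_atBot hδ)
  simpa using h1.const_mul C

theorem tendsto_endpoint (hγ : IsEllZero z γ x) : Tendsto γ (𝓝[<] 0) (𝓝 x) := by
  have := (hγ.continuousOn 0 (by simp)).tendsto
  rw [hγ.endpoint] at this
  exact this.mono_left (nhdsWithin_mono _ Iio_subset_Iic_self)

theorem exists_end_bound (hγ : IsEllZero z γ x) {φ : ℂ → ℂ} (hφ : ContinuousAt φ x) :
    ∃ C e : ℝ, -1 < e ∧ ∀ᶠ t in 𝓝[<] (0 : ℝ), ‖φ (γ t)‖ ≤ C * |t| ^ e := by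
  refine ⟨‖φ x‖ + 1, 0, by norm_num, ?_⟩
  have h1 := (hφ.tendsto.comp hγ.tendsto_endpoint).norm.eventually_le_const
    (lt_add_one ‖φ x‖)
  filter_upwards [h1] with t ht
  simpa using ht

/-- Along two contours, the values of a primitive of a decaying function have the same limit at
`-i∞`. -/
theorem tendsto_sub_zero {x' : ℂ} {γ' : ℝ → ℂ} (hγ : IsEllZero z γ x) (hγ' : IsEllZero z γ' x')
    {κ : ℝ} (hκ : 0 < κ) {φ Φ : ℂ → ℂ} (hΦ : ∀ w ∈ G z, HasDerivAt Φ (φ w) w)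
    (hφ : LeftDecay κ z φ) : Tendsto (fun t => Φ (γ' t) - Φ (γ t)) atBot (𝓝 0) := by
  obtain ⟨a, ha, him⟩ := hγ.origin_im
  obtain ⟨a', ha', him'⟩ := hγ'.origin_im
  obtain ⟨B, hB⟩ := hγ.exists_norm_le
  obtain ⟨B', hB'⟩ := hγ'.exists_norm_le
  set b := min a a'
  have hb : 0 < b := lt_min ha ha'
  set K := max B B'
  obtain ⟨C, hC⟩ := hφ.eventually_norm_le hκ hb K
  set δ := κ * b / 2
  have hδ : 0 < δ := by positivity
  -- This will bound the difference by the mean value inequality on the segment from γ(t) to γ'(t):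
  -- its length is O(|t|), and it stays in the convex left half-plane, where φ is O(e^{δt}).
  have hlim : Tendsto (fun t : ℝ => C * Real.exp (δ * t) * (2 * K * (1 + |t|))) atBot (𝓝 0) := by
    have l1 := (Real.tendsto_pow_mul_exp_neg_atTop_nhds_zero 0).comp
      (tendsto_neg_atBot_atTop.const_mul_atTop hδ)
    have l2 := (Real.tendsto_pow_mul_exp_neg_atTop_nhds_zero 1).comp
      (tendsto_neg_atBot_atTop.const_mul_atTop hδ)
    have l3 := (l1.add (l2.const_mul (1 / δ))).const_mul (C * (2 * K))
    simp only [mul_zero, add_zero] at l3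
    refine l3.congr' ?_
    filter_upwards [eventually_le_atBot 0] with t ht
    rw [abs_of_nonpos ht]
    simp only [Function.comp, pow_zero, pow_one]
    have : -(δ * -t) = δ * t := by ring
    rw [this]
    field_simp
  refine squeeze_zero_norm' ?_ hlim
  filter_upwards [hC, him, him', hγ.origin_re, hγ'.origin_re, eventually_le_atBot 0]
    with t h1 h2 h2' h3 h3' h4
  have n1 : ‖γ t‖ ≤ K * (1 + |t|) :=
    (hB t h4).trans (mul_le_mul_of_nonneg_right (le_max_left _ _) (by positivity))
  have n2 : ‖γ' t‖ ≤ K * (1 + |t|) :=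
    (hB' t h4).trans (mul_le_mul_of_nonneg_right (le_max_right _ _) (by positivity))
  have i1 : (γ t).im ≤ b * t := h2.trans (mul_le_mul_of_nonpos_right (min_le_left _ _) h4)
  have i2 : (γ' t).im ≤ b * t := h2'.trans (mul_le_mul_of_nonpos_right (min_le_right _ _) h4)
  have r : ∀ w ∈ segment ℝ (γ t) (γ' t), ∀ p, w.re < (z p).re := by
    intro w hw p
    exact (convex_halfSpace_re_lt (z p).re).segment_subset (h3 p) (h3' p) hw
  have hle : ∀ w ∈ segment ℝ (γ t) (γ' t), ‖φ w‖ ≤ C * Real.exp (δ * t) := by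
    intro w hw
    refine h1 w (r w hw) ((convex_halfSpace_im_le (b * t)).segment_subset i1 i2 hw) ?_
    have := (convex_closedBall (0 : ℂ) (K * (1 + |t|))).segment_subset
      (x := γ t) (y := γ' t) (by simpa using n1) (by simpa using n2) hw
    simpa using this
  have h0 : 0 ≤ C * Real.exp (δ * t) :=
    (norm_nonneg _).trans (hle _ (left_mem_segment ℝ _ _))
  calc ‖Φ (γ' t) - Φ (γ t)‖ ≤ C * Real.exp (δ * t) * ‖γ' t - γ t‖ :=
        Convex.norm_image_sub_le_of_norm_hasDerivWithin_le
          (fun w hw => (hΦ w (mem_G_of_re_lt (r w hw))).hasDerivWithinAt) hle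
          (convex_segment _ _) (left_mem_segment ℝ _ _) (right_mem_segment ℝ _ _)
    _ ≤ C * Real.exp (δ * t) * (2 * K * (1 + |t|)) := by
        gcongr
        have := norm_sub_le (γ' t) (γ t)
        linarith

/-- Near a point that is reached with nonzero velocity, powers with exponent of real part larger
than `-1` are integrable along the contour. -/
theorem exists_end_bound_cpow (hγ : IsEllZero z γ x) {ψ : ℂ → ℂ} (hψ : ContinuousAt ψ x) {s : ℂ}
    (hs : -1 < s.re) : ∃ C e : ℝ, -1 < e ∧
      ∀ᶠ t in 𝓝[<] (0 : ℝ), ‖(I * (γ t - x)) ^ s * ψ (γ t)‖ ≤ C * |t| ^ e := by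
  obtain ⟨w, hw, hd⟩ := hγ.end_velocity
  have hw' : 0 < ‖w‖ := norm_pos_iff.2 hw
  have ho := (hasDerivWithinAt_iff_isLittleO.1 hd).def (half_pos hw')
  rw [hγ.endpoint] at ho
  have ho' := nhdsWithin_mono (0 : ℝ) Iio_subset_Iic_self ho
  have hψb := (hψ.tendsto.comp hγ.tendsto_endpoint).norm.eventually_le_const
    (lt_add_one ‖ψ x‖)
  -- Nonzero final velocity w traps |γ(t) - x| between |w||t|/2 and 2|w||t|. The sum of the two
  -- powers covers both signs of Re s, and the exponential bounds the effect of the argument.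
  refine ⟨((‖w‖ / 2) ^ s.re + (2 * ‖w‖) ^ s.re) * Real.exp (Real.pi * |s.im|) * (‖ψ x‖ + 1),
    s.re, hs, ?_⟩
  filter_upwards [ho', hψb, self_mem_nhdsWithin] with t h1 h2 ht
  have ht' : t < 0 := ht
  simp only [sub_zero, real_smul, Real.norm_eq_abs] at h1
  have htp : 0 < |t| := abs_pos.2 ht'.ne
  have hwt : ‖(t : ℂ) * w‖ = ‖w‖ * |t| := by rw [norm_mul, norm_real, Real.norm_eq_abs, mul_comm]
  have lower : ‖w‖ / 2 * |t| ≤ ‖γ t - x‖ := by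
    have := norm_sub_norm_le ((t : ℂ) * w) (t * w - (γ t - x))
    rw [sub_sub_cancel, norm_sub_rev ((t : ℂ) * w), hwt] at this
    linarith
  have upper : ‖γ t - x‖ ≤ 2 * ‖w‖ * |t| := by
    have := norm_add_le (γ t - x - t * w) ((t : ℂ) * w)
    rw [sub_add_cancel, hwt] at this
    nlinarith
  have hpos : 0 < ‖γ t - x‖ := lt_of_lt_of_le (by positivity) lower
  have hpow : ‖γ t - x‖ ^ s.re ≤ ((‖w‖ / 2) ^ s.re + (2 * ‖w‖) ^ s.re) * |t| ^ s.re := by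
    rw [add_mul, ← Real.mul_rpow (by positivity) (by positivity),
      ← Real.mul_rpow (by positivity) (by positivity)]
    rcases le_or_gt 0 s.re with h | h
    · have := Real.rpow_le_rpow hpos.le upper h
      have h' : 0 ≤ (‖w‖ / 2 * |t|) ^ s.re := by positivity
      linarith
    · have := Real.rpow_le_rpow_of_nonpos (by positivity) lower h.le
      have h' : 0 ≤ (2 * ‖w‖ * |t|) ^ s.re := by positivity
      linarith
  have hcp : ‖(I * (γ t - x)) ^ s‖ ≤ ‖γ t - x‖ ^ s.re * Real.exp (Real.pi * |s.im|) := by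
    refine (norm_cpow_le _ _).trans ?_
    rw [norm_mul, norm_I, one_mul, div_eq_mul_inv, ← Real.exp_neg]
    gcongr
    refine (neg_le_abs _).trans ?_
    rw [abs_mul]
    gcongr
    exact abs_arg_le_pi _
  have h2' : ‖ψ (γ t)‖ ≤ ‖ψ x‖ + 1 := h2
  calc ‖(I * (γ t - x)) ^ s * ψ (γ t)‖
      ≤ (((‖w‖ / 2) ^ s.re + (2 * ‖w‖) ^ s.re) * |t| ^ s.re * Real.exp (Real.pi * |s.im|)) *
        (‖ψ x‖ + 1) := by
        rw [norm_mul]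
        gcongr
        exact hcp.trans (by gcongr)
    _ = _ := by ring

end IsEllZero

/-! ### The normalized primitive and its local form at z_m. -/

/-- The integrand of `W₊` has a primitive on `G` that vanishes at `-i∞`, and that is given by the
contour integrals. -/
theorem exists_normalized_primitive (ε : ℝ) (hε : 0 < ε) (c : Fin P → ℂ) {z : Fin P → ℂ}
    (hz : ∀ p, 0 < (z p).im) {lam : ℝ} (hlam : 0 < lam) (v : Fin P → ℂ) {ell : ℂ → ℝ → ℂ}
    (hell : ∀ x ∈ G z, IsEllZero z (ell x) x) :
    ∃ Φ : ℂ → ℂ, (∀ w ∈ G z, HasDerivAt Φ (integrand ε c z v lam w) w) ∧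
      (∀ x γ, IsEllZero z γ x → Tendsto (fun t => Φ (γ t)) atBot (𝓝 0)) ∧
      ∀ x ∈ G z, contourIntegral (ell x) (integrand ε c z v lam) = Φ x := by
  have hκ : 0 < lam / ε := div_pos hlam hε
  have hdiff := differentiableOn_integrand ε c z v lam
  have hleft := leftDecay_integrand ε c z v lam
  obtain ⟨Φ, hΦ⟩ := exists_primitive_of_vertical_segments (isOpen_G z)
    (fun w hw => vertical_segment_subset_G hz hw) (ofReal_mem_G hz) hdiff
  -- Stated for every primitive because it is used twice: to find the limit K of one primitive at
  -- -i∞, and again after subtracting K.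
  have lim : ∀ Ψ : ℂ → ℂ, (∀ w ∈ G z, HasDerivAt Ψ (integrand ε c z v lam w) w) → ∀ x ∈ G z,
      Tendsto (fun t => Ψ (ell x t)) atBot
        (𝓝 (Ψ x - contourIntegral (ell x) (integrand ε c z v lam))) := by
    intro Ψ hΨ x hx
    exact (hell x hx).tendsto_atBot_of_primitive hdiff.continuousOn hΨ
      ((hell x hx).exists_exp_bound hκ hleft)
      ((hell x hx).exists_end_bound (hdiff.continuousOn.continuousAt ((isOpen_G z).mem_nhds hx)))
      ((hΨ x hx).continuousAt.tendsto.comp (hell x hx).tendsto_endpoint)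
  have h0 : ((0 : ℝ) : ℂ) ∈ G z := ofReal_mem_G hz 0
  set K := Φ (0 : ℝ) - contourIntegral (ell (0 : ℝ)) (integrand ε c z v lam)
  have hΦ' : ∀ w ∈ G z, HasDerivAt (fun w => Φ w - K) (integrand ε c z v lam w) w :=
    fun w hw => (hΦ w hw).sub_const K
  have hzero : ∀ x γ, IsEllZero z γ x → Tendsto (fun t => Φ (γ t) - K) atBot (𝓝 0) := by
    intro x γ hγ
    have := ((hell _ h0).tendsto_sub_zero hγ hκ hΦ hleft).add ((lim Φ hΦ _ h0).sub_const K)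
    simpa [K] using this
  refine ⟨fun w => Φ w - K, hΦ', hzero, fun x hx => ?_⟩
  have := tendsto_nhds_unique (hzero x _ (hell x hx)) (lim _ hΦ' x hx)
  exact (sub_eq_zero.1 this.symm).symm

theorem differentiableOn_iteratedDeriv {U : Set ℂ} (hU : IsOpen U) {K : ℂ → ℂ}
    (hK : DifferentiableOn ℂ K U) (n : ℕ) : DifferentiableOn ℂ (iteratedDeriv n K) U := by
  induction n with
  | zero => simpa using hK
  | succ n ih => rw [iteratedDeriv_succ]; exact ih.deriv hU

theorem cpow_neg_sub_natCast {u : ℂ} (hu : u ≠ 0) (α : ℂ) (N : ℕ) :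
    u ^ (-(α - N)) = u ^ (-α) * u ^ N := by
  rw [neg_sub, sub_eq_add_neg, cpow_add _ _ hu, cpow_natCast, mul_comm]

theorem hasDerivAt_I_mul_sub_cpow {w z₀ : ℂ} (h : I * (w - z₀) ∈ slitPlane) (a : ℂ) :
    HasDerivAt (fun s => (I * (s - z₀)) ^ a) (a * (I * (w - z₀)) ^ (a - 1) * I) w := by
  have h1 : HasDerivAt (fun s => I * (s - z₀)) I w := by
    simpa using ((hasDerivAt_id w).sub_const z₀).const_mul I
  exact h1.cpow_const h

/-- Repeated integration by parts: up to a nonzero factor and a term that is `u ^ (-α)` times a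
holomorphic function, a primitive of `-u ^ (-α - 1) K` is a primitive of
`u ^ (-(α - N) - 1) K⁽ᴺ⁾`, where `u = i (w - zₘ)`. -/
theorem exists_integration_by_parts {z : Fin P → ℂ} (m : Fin P) {U : Set ℂ} (hU : IsOpen U)
    (hGU : G z ⊆ U) {K Φ : ℂ → ℂ} (hK : DifferentiableOn ℂ K U) {κ : ℝ} (hκ : 0 < κ)
    (hKd : LeftDecay κ z K) {α : ℂ}
    (hΦ : ∀ w ∈ G z, HasDerivAt Φ (-((I * (w - z m)) ^ (-α - 1) * K w)) w)
    (hΦ0 : ∀ x γ, IsEllZero z γ x → Tendsto (fun t => Φ (γ t)) atBot (𝓝 0))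
    (N : ℕ) (hα : ∀ j < N, α ≠ (j : ℂ)) :
    ∃ (k : ℂ) (B : ℂ → ℂ), k ≠ 0 ∧ DifferentiableOn ℂ B U ∧
      (∀ w ∈ G z, HasDerivAt (fun s => k * Φ s + (I * (s - z m)) ^ (-α) * B s)
        ((I * (w - z m)) ^ (-(α - N) - 1) * iteratedDeriv N K w) w) ∧
      ∀ x γ, IsEllZero z γ x → Tendsto
        (fun t => k * Φ (γ t) + (I * (γ t - z m)) ^ (-α) * B (γ t)) atBot (𝓝 0) := by
  induction N with
  | zero =>
    refine ⟨-1, fun _ => 0, by norm_num, differentiableOn_const _, fun w hw => ?_,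
      fun x γ hγ => ?_⟩
    · simpa using (hΦ w hw).fun_neg
    · simpa using (hΦ0 x γ hγ).neg
  | succ N ih =>
    obtain ⟨k, B, hk, hB, hd, ht⟩ := ih fun j hj => hα j (hj.trans (Nat.lt_succ_self N))
    have hαN : α - N ≠ 0 := sub_ne_zero.2 (hα N (Nat.lt_succ_self N))
    have hKN := differentiableOn_iteratedDeriv hU hK N
    -- Differentiating u^{-(α-N)} K⁽ᴺ⁾ gives u^{-(α-N)} K⁽ᴺ⁺¹⁾ minus i(α - N) u^{-(α-N)-1} K⁽ᴺ⁾.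
    -- Adding i(α - N) times the previous primitive cancels the latter; α ≠ N keeps the new k
    -- nonzero.
    have hform : ∀ s ∈ G z, I * (α - N) * (k * Φ s + (I * (s - z m)) ^ (-α) * B s) +
        (I * (s - z m)) ^ (-(α - N)) * iteratedDeriv N K s =
        I * (α - N) * k * Φ s + (I * (s - z m)) ^ (-α) *
          ((I * (s - z m)) ^ N * iteratedDeriv N K s + I * (α - N) * B s) := by
      intro s hs
      rw [cpow_neg_sub_natCast (slitPlane_ne_zero (hs m).1)]
      ring
    refine ⟨I * (α - N) * k, fun s => (I * (s - z m)) ^ N * iteratedDeriv N K s +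
      I * (α - N) * B s, mul_ne_zero (mul_ne_zero I_ne_zero hαN) hk, ?_, fun w hw => ?_,
      fun x γ hγ => ?_⟩
    · exact (DifferentiableOn.mul (by fun_prop) hKN).add (hB.const_mul _)
    · have h1 := ((hd w hw).const_mul (I * (α - N))).add
        ((hasDerivAt_I_mul_sub_cpow (hw m).1 (-(α - N))).mul
          (hKN.differentiableAt (hU.mem_nhds (hGU hw))).hasDerivAt)
      refine (h1.congr_of_eventuallyEq ?_).congr_deriv ?_
      · filter_upwards [(isOpen_G z).mem_nhds hw] with s hs
        exact (hform s hs).symm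
      · rw [iteratedDeriv_succ]
        have e : -(α - ((N + 1 : ℕ) : ℂ)) - 1 = -(α - N) := by push_cast; ring
        rw [e]
        ring
    · have h1 := (leftDecay_cpow z (-(α - N)) (z m)).mul (hKd.iteratedDeriv N)
      rw [zero_add] at h1
      have h2 := ((ht x γ hγ).const_mul (I * (α - N))).add (hγ.tendsto_zero hκ h1)
      rw [mul_zero, add_zero] at h2
      refine h2.congr' ?_
      filter_upwards [eventually_lt_atBot 0] with t ht
      exact hform _ (hγ.mem_G t ht)

theorem exists_const_of_hasDerivAt_eq {D : Set ℂ} (hD : IsOpen D) (hD' : IsPreconnected D)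
    {Ψ T ψ : ℂ → ℂ} (h1 : ∀ w ∈ D, HasDerivAt Ψ (ψ w) w) (h2 : ∀ w ∈ D, HasDerivAt T (ψ w) w) :
    ∃ a, ∀ w ∈ D, Ψ w = T w + a := by
  obtain ⟨a, ha⟩ := hD.exists_is_const_of_deriv_eq_zero hD' (f := fun w => Ψ w - T w)
    (fun w hw => ((h1 w hw).sub (h2 w hw)).differentiableAt.differentiableWithinAt)
    (fun w hw => by rw [((h1 w hw).fun_sub (h2 w hw)).deriv, sub_self]; rfl)
  exact ⟨a, fun w hw => by rw [← ha w hw]; ring⟩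

/-- Local form of the primitive at `zₘ` when `Re α < N` and `α` is none of `0, …, N - 1`. -/
theorem exists_local_form {z : Fin P → ℂ} (hz : ∀ p, 0 < (z p).im)
    (hre : StrictMono fun p => (z p).re) {m : Fin P} {K Φ : ℂ → ℂ}
    (hK : DifferentiableOn ℂ K (G z ∪ slab z m)) {κ : ℝ} (hκ : 0 < κ)
    (hKd : LeftDecay κ z K) {α : ℂ}
    (hΦ : ∀ w ∈ G z, HasDerivAt Φ (-((I * (w - z m)) ^ (-α - 1) * K w)) w)
    (hΦ0 : ∀ x γ, IsEllZero z γ x → Tendsto (fun t => Φ (γ t)) atBot (𝓝 0))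
    {γ : ℝ → ℂ} (hγ : IsEllZero z γ (z m))
    {N : ℕ} (hα : ∀ j < N, α ≠ (j : ℂ)) (hN : α.re < N) :
    ∃ (k : ℂ) (E : ℂ → ℂ), k ≠ 0 ∧ DifferentiableOn ℂ E (slab z m) ∧
      ∀ w ∈ slab z m ∩ G z, k * Φ w = contourIntegral γ
        (fun s => (I * (s - z m)) ^ (-(α - N) - 1) * iteratedDeriv N K s) +
          (I * (w - z m)) ^ (-α) * E w := by
  have hU : IsOpen (G z ∪ slab z m) := (isOpen_G z).union (isOpen_slab z m)
  have hzm : z m ∈ slab z m := mem_slab_of_re_eq hre (hz m) rfl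
  obtain ⟨k, B, hk, hB, hd, ht⟩ := exists_integration_by_parts m hU subset_union_left hK hκ hKd hΦ
    hΦ0 N hα
  have hKN := differentiableOn_iteratedDeriv hU hK N
  have hβ : 0 < (-(α - N)).re := by simp; exact hN
  obtain ⟨A, A', hA⟩ := exists_solution_euler_equation (isOpen_slab z m)
    ((convex_slab z m).starConvex hzm) (hKN.mono subset_union_right) hβ
  -- With β = N - α, the derivative of u^β A is i u^{β-1} ((w - z_m) A' + βA), so the Euler equation
  -- makes -i u^β A a primitive.
  have hT : ∀ w ∈ slab z m ∩ G z, HasDerivAt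
      (fun s => -I * ((I * (s - z m)) ^ (-(α - N)) * A s))
      ((I * (w - z m)) ^ (-(α - N) - 1) * iteratedDeriv N K w) w := by
    intro w hw
    have hu := slitPlane_ne_zero (hw.2 m).1
    refine (((hasDerivAt_I_mul_sub_cpow (hw.2 m).1 (-(α - N))).mul
      (hA w hw.1).1).const_mul (-I)).congr_deriv ?_
    have e : (I * (w - z m)) ^ (-(α - N)) =
        (I * (w - z m)) ^ (-(α - N) - 1) * (I * (w - z m)) := by
      rw [cpow_sub _ _ hu, cpow_one, div_mul_cancel₀ _ hu]
    rw [← (hA w hw.1).2, e]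
    linear_combination (-((I * (w - z m)) ^ (-(α - N) - 1) * ((w - z m) * A' w +
      -(α - N) * A w))) * I_sq
  obtain ⟨L, hL⟩ := exists_const_of_hasDerivAt_eq ((isOpen_slab z m).inter (isOpen_G z))
    (isPreconnected_slab_inter_G hz hre m) (fun w hw => hd w hw.2) hT
  -- The explicit primitive vanishes at z_m, so the constant L is the limit at the end of the
  -- contour. Together with the limit 0 at -i∞ this identifies L with the contour integral.
  have hLlim : Tendsto (fun t => k * Φ (γ t) + (I * (γ t - z m)) ^ (-α) * B (γ t)) (𝓝[<] 0)
      (𝓝 L) := by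
    have l0 : Tendsto (fun t => I * (γ t - z m)) (𝓝[<] 0) (𝓝 0) := by
      have := (hγ.tendsto_endpoint.sub_const (z m)).const_mul I
      simpa using this
    have l1 : Tendsto (fun t => (I * (γ t - z m)) ^ (-(α - N))) (𝓝[<] 0) (𝓝 0) := by
      have := (continuousAt_cpow_const_of_re_pos (z := 0) (Or.inl le_rfl) hβ).tendsto
      rw [zero_cpow (fun h0 => by rw [h0] at hβ; simp at hβ)] at this
      exact this.comp l0
    have l2 := (hA _ hzm).1.continuousAt.tendsto.comp hγ.tendsto_endpoint
    have l3 := ((l1.mul l2).const_mul (-I)).add_const L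
    rw [zero_mul, mul_zero, zero_add] at l3
    refine l3.congr' ?_
    filter_upwards [hγ.tendsto_endpoint ((isOpen_slab z m).mem_nhds hzm), self_mem_nhdsWithin]
      with t h1 h2
    exact (hL _ ⟨h1, hγ.mem_G t h2⟩).symm
  have hφc : ContinuousOn (fun s => (I * (s - z m)) ^ (-(α - N) - 1) * iteratedDeriv N K s)
      (G z) := by
    refine ContinuousOn.mul ?_ (hKN.continuousOn.mono subset_union_left)
    exact fun s hs => (hasDerivAt_I_mul_sub_cpow (hs m).1 _).continuousAt.continuousWithinAt
  have hdec := (leftDecay_cpow z (-(α - N) - 1) (z m)).mul (hKd.iteratedDeriv N)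
  rw [zero_add] at hdec
  have hFTC := hγ.tendsto_atBot_of_primitive hφc hd (hγ.exists_exp_bound hκ hdec)
    (hγ.exists_end_bound_cpow
      (hKN.continuousOn.continuousAt (hU.mem_nhds (Or.inr hzm)))
      (by simp only [sub_re, one_re]; linarith)) hLlim
  have hLe := sub_eq_zero.1 (tendsto_nhds_unique hFTC (ht _ _ hγ))
  refine ⟨k, fun s => -I * ((I * (s - z m)) ^ N * A s) - B s, hk, ?_, fun w hw => ?_⟩
  · refine DifferentiableOn.sub (DifferentiableOn.const_mul (DifferentiableOn.mul (by fun_prop)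
      fun w hw => ?_) _) (hB.mono subset_union_right)
    exact (hA w hw).1.differentiableAt.differentiableWithinAt
  · have h1 := hL w hw
    rw [cpow_neg_sub_natCast (slitPlane_ne_zero (hw.2 m).1)] at h1
    rw [← hLe]
    linear_combination h1

/-- Local form of the primitive at `zₘ` when `α = n` is a natural number. -/
theorem exists_local_form_log {z : Fin P → ℂ} (hz : ∀ p, 0 < (z p).im)
    (hre : StrictMono fun p => (z p).re) {m : Fin P} {K Φ : ℂ → ℂ}
    (hK : DifferentiableOn ℂ K (G z ∪ slab z m)) {κ : ℝ} (hκ : 0 < κ)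
    (hKd : LeftDecay κ z K) {α : ℂ}
    (hΦ : ∀ w ∈ G z, HasDerivAt Φ (-((I * (w - z m)) ^ (-α - 1) * K w)) w)
    (hΦ0 : ∀ x γ, IsEllZero z γ x → Tendsto (fun t => Φ (γ t)) atBot (𝓝 0))
    {n : ℕ} (hα : α = n) :
    ∃ (k : ℂ) (E : ℂ → ℂ), k ≠ 0 ∧ DifferentiableOn ℂ E (slab z m) ∧
      ∀ w ∈ slab z m ∩ G z, k * Φ w = -I * iteratedDeriv n K (z m) * log (I * (w - z m)) +
          (I * (w - z m)) ^ (-α) * E w := by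
  have hU : IsOpen (G z ∪ slab z m) := (isOpen_G z).union (isOpen_slab z m)
  have hzm : z m ∈ slab z m := mem_slab_of_re_eq hre (hz m) rfl
  obtain ⟨k, B, hk, hB, hd, -⟩ := exists_integration_by_parts m hU subset_union_left hK hκ hKd hΦ
    hΦ0 n (fun j hj => by rw [hα]; exact_mod_cast hj.ne')
  have hKN := (differentiableOn_iteratedDeriv hU hK n).mono
    (subset_union_right : slab z m ⊆ G z ∪ slab z m)
  set r := iteratedDeriv n K (z m)
  -- The exponent is now -1. Splitting K⁽ⁿ⁾ = r + (w - z_m) · `dslope`, the part r/u integrates to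
  -- the logarithm and the rest to the holomorphic `D`.
  obtain ⟨D, hD⟩ := exists_primitive_of_starConvex (isOpen_slab z m)
    ((convex_slab z m).starConvex hzm)
    ((differentiableOn_dslope ((isOpen_slab z m).mem_nhds hzm)).2 hKN)
  have hT : ∀ w ∈ slab z m ∩ G z, HasDerivAt
      (fun s => -I * r * log (I * (s - z m)) + -I * D s)
      ((I * (w - z m)) ^ (-(α - n) - 1) * iteratedDeriv n K w) w := by
    intro w hw
    have hu := slitPlane_ne_zero (hw.2 m).1
    have hne : w - z m ≠ 0 := (mul_ne_zero_iff.1 hu).2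
    have h1 : HasDerivAt (fun s => I * (s - z m)) I w := by
      simpa using ((hasDerivAt_id w).sub_const (z m)).const_mul I
    refine (((h1.clog (hw.2 m).1).const_mul (-I * r)).add
      ((hD w hw.1).const_mul (-I))).congr_deriv ?_
    have e : iteratedDeriv n K w = r + (w - z m) * dslope (iteratedDeriv n K) (z m) w := by
      have := sub_smul_dslope (iteratedDeriv n K) (z m) w
      rw [smul_eq_mul] at this
      rw [this]; ring
    rw [e, hα, sub_self, neg_zero, zero_sub, cpow_neg_one]
    field_simp
    linear_combination (-r - (w - z m) * dslope (iteratedDeriv n K) (z m) w) * I_sq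
  obtain ⟨L, hL⟩ := exists_const_of_hasDerivAt_eq ((isOpen_slab z m).inter (isOpen_G z))
    (isPreconnected_slab_inter_G hz hre m) (fun w hw => hd w hw.2) hT
  -- As u^{-α} u^n = 1, the constant L is absorbed into E and imposes no condition.
  refine ⟨k, fun s => (I * (s - z m)) ^ n * (L - I * D s) - B s, hk, ?_, fun w hw => ?_⟩
  · refine DifferentiableOn.sub (DifferentiableOn.mul (by fun_prop) (DifferentiableOn.sub
      (differentiableOn_const _) (DifferentiableOn.const_mul (fun w hw => ?_) _)))
      (hB.mono subset_union_right)
    exact (hD w hw).differentiableAt.differentiableWithinAt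
  · have h1 := hL w hw
    have h2 : (I * (w - z m)) ^ (-α) * (I * (w - z m)) ^ n = 1 := by
      rw [hα, cpow_neg, cpow_natCast]
      exact inv_mul_cancel₀ (pow_ne_zero _ (slitPlane_ne_zero (hw.2 m).1))
    linear_combination h1 - (L - I * D w) * h2

/-! ### Extension across the cuts. -/

/-- A function on `G` that has a holomorphic extension across the branch cut above `zₘ`, including
the branch point. -/
def ExtendsAcross (z : Fin P → ℂ) (m : Fin P) (W : ℂ → ℂ) : Prop :=
  ∃ J : ℂ → ℂ, DifferentiableOn ℂ J (slab z m) ∧ ∀ w ∈ slab z m ∩ G z, J w = W w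

/-- A function is analytic in the upper half-plane if and only if it extends across each cut. -/
theorem analyticInUpperHalfPlane_iff {z : Fin P → ℂ}
    (hre : StrictMono fun p => (z p).re) {W : ℂ → ℂ} (hW : DifferentiableOn ℂ W (G z)) :
    AnalyticInUpperHalfPlane z W ↔ ∀ m, ExtendsAcross z m W := by
  constructor
  · rintro ⟨F, hF, hFW⟩ m
    exact ⟨F, fun w hw => (hF w hw.1).differentiableAt.differentiableWithinAt,
      fun w hw => hFW w hw.2 hw.1.1⟩
  · intro hext
    choose J hJ hJW using hext
    classical
    set F : ℂ → ℂ := fun x => if x ∈ G z then W x else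
      if hx : ∃ m, x.re = (z m).re then J hx.choose x else 0 with hF
    have hFG : ∀ x ∈ G z, F x = W x := fun x hx => if_pos hx
    have hFJ : ∀ m, ∀ x ∈ slab z m, F x = J m x := by
      intro m x hx
      by_cases hxG : x ∈ G z
      · rw [hFG x hxG, hJW m x ⟨hx, hxG⟩]
      · have hex : ∃ m, x.re = (z m).re := by
          by_contra! hno
          exact hxG (mem_G_iff.2 fun p hp => absurd hp (hno p))
        -- The real parts of the other z_p are excluded from the slab, so the chosen index is forced
        -- and the local extensions glue.
        have hm : hex.choose = m := by
          by_contra hne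
          exact re_ne_of_mem_slab hx hne hex.choose_spec
        simp only [hF]
        rw [if_neg hxG, dif_pos hex, hm]
    refine ⟨F, fun x hx => ?_, fun x hx _ => hFG x hx⟩
    by_cases hxG : x ∈ G z
    · refine (hW.analyticAt ((isOpen_G z).mem_nhds hxG)).congr ?_
      filter_upwards [(isOpen_G z).mem_nhds hxG] with y hy
      exact (hFG y hy).symm
    · obtain ⟨m, hm⟩ : ∃ m, x.re = (z m).re := by
        by_contra! hno
        exact hxG (mem_G_iff.2 fun p hp => absurd hp (hno p))
      have hxm : x ∈ slab z m := mem_slab_of_re_eq hre hx hm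
      refine ((hJ m).analyticAt ((isOpen_slab z m).mem_nhds hxm)).congr ?_
      filter_upwards [(isOpen_slab z m).mem_nhds hxm] with y hy
      exact (hFJ m y hy).symm

/-- Extension across a cut is not affected by a nonvanishing holomorphic factor and a holomorphic
summand. -/
theorem extendsAcross_iff_of_eq {z : Fin P → ℂ} {m : Fin P} {W R χ E : ℂ → ℂ}
    (hR : DifferentiableOn ℂ R (slab z m)) (hR0 : ∀ w ∈ slab z m, R w ≠ 0)
    (hE : DifferentiableOn ℂ E (slab z m))
    (h : ∀ w ∈ slab z m ∩ G z, W w = R w * (χ w + E w)) :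
    ExtendsAcross z m W ↔ ExtendsAcross z m χ := by
  constructor
  · rintro ⟨J, hJ, hJW⟩
    refine ⟨fun w => J w / R w - E w, (hJ.div hR hR0).sub hE, fun w hw => ?_⟩
    simp only
    rw [hJW w hw, h w hw, mul_div_cancel_left₀ _ (hR0 w hw.1), add_sub_cancel_right]
  · rintro ⟨J, hJ, hJχ⟩
    refine ⟨fun w => R w * (J w + E w), hR.mul (hJ.add hE), fun w hw => ?_⟩
    rw [h w hw, ← hJχ w hw]

/-- A function of the logarithm that extends across the cut has no jump there. -/
theorem ExtendsAcross.eq_boundary_values {z : Fin P → ℂ} (hz : ∀ p, 0 < (z p).im)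
    (hre : StrictMono fun p => (z p).re) {m : Fin P} {q : ℂ → ℂ} (hq : Continuous q)
    (h : ExtendsAcross z m (fun w => q (log (I * (w - z m))))) :
    q (Real.pi * I) = q (-(Real.pi * I)) := by
  obtain ⟨J, hJ, hJq⟩ := h
  have hmap : ∀ u : ℂ, I * (z m - I * u - z m) = u := by
    intro u
    linear_combination -u * I_sq
  have hmem : z m - I * (-(1 : ℝ) : ℂ) ∈ slab z m :=
    mem_slab_of_re_eq hre (by simp; linarith [hz m]) (by simp)
  have hS : ∀ᶠ u in 𝓝 (-(1 : ℝ) : ℂ), z m - I * u ∈ slab z m :=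
    (by fun_prop : Continuous fun u : ℂ => z m - I * u).continuousAt.eventually_mem
      ((isOpen_slab z m).mem_nhds hmem)
  have hc : ContinuousAt (fun u => J (z m - I * u)) (-(1 : ℝ) : ℂ) := by
    refine ContinuousAt.comp (f := fun u : ℂ => z m - I * u) ?_ (by fun_prop)
    exact hJ.continuousOn.continuousAt ((isOpen_slab z m).mem_nhds hmem)
  have := eq_boundary_values_of_continuousAt hq one_pos hc (by
    filter_upwards [hS] with u hu hsl
    have hG := (mem_G_iff_of_mem_slab hz hu).2 (by rwa [hmap])
    simp only [hJq _ ⟨hu, hG⟩, hmap])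
  simpa using this

/-- A multiple of a power, with negative real part of the exponent or with a non-integral exponent,
extends across the cut only if it vanishes. -/
theorem extendsAcross_cpow_iff {z : Fin P → ℂ} (hz : ∀ p, 0 < (z p).im)
    (hre : StrictMono fun p => (z p).re) {m : Fin P} {α L : ℂ}
    (hα : α.re < 0 ∨ ∀ n : ℤ, α ≠ n) :
    ExtendsAcross z m (fun w => L * (I * (w - z m)) ^ α) ↔ L = 0 := by
  refine ⟨fun h => ?_, fun h => ⟨fun _ => 0, differentiableOn_const _, fun w _ => by simp [h]⟩⟩
  rcases hα with hα | hα
  · obtain ⟨J, hJ, hJL⟩ := h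
    have hzm : z m ∈ slab z m := mem_slab_of_re_eq hre (hz m) rfl
    have hmap : ∀ τ : ℝ, I * (z m - I * τ - z m) = τ := by
      intro τ
      linear_combination -(τ : ℂ) * I_sq
    -- Approach z_m vertically from below, where u = τ > 0. Multiplying the extension L τ^α by
    -- τ^{-α} → 0 leaves the constant L, which must therefore be 0.
    have l0 : Tendsto (fun τ : ℝ => z m - I * τ) (𝓝[>] 0) (𝓝 (z m)) := by
      have : Tendsto (fun τ : ℝ => z m - I * τ) (𝓝 0) (𝓝 (z m - I * (0 : ℝ))) :=
        (by fun_prop : Continuous fun τ : ℝ => z m - I * τ).tendsto 0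
      simp only [ofReal_zero, mul_zero, sub_zero] at this
      exact this.mono_left nhdsWithin_le_nhds
    have l1 := (hJ.continuousOn.continuousAt
      ((isOpen_slab z m).mem_nhds hzm)).tendsto.comp l0
    have hre' : 0 < (-α).re := by simpa using hα
    have hα0 : α ≠ 0 := by rintro rfl; simp at hα
    have l2 : Tendsto (fun τ : ℝ => (τ : ℂ) ^ (-α)) (𝓝[>] 0) (𝓝 0) := by
      have := (continuous_ofReal_cpow_const hre').tendsto 0
      rw [ofReal_zero, zero_cpow (neg_ne_zero.2 hα0)] at this
      exact this.mono_left nhdsWithin_le_nhds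
    have l3 := l1.mul l2
    rw [mul_zero] at l3
    refine tendsto_nhds_unique (Tendsto.congr' ?_ l3) tendsto_const_nhds |>.symm
    filter_upwards [l0 ((isOpen_slab z m).mem_nhds hzm), self_mem_nhdsWithin] with τ h1 h2
    have h2' : (0 : ℝ) < τ := h2
    have hG := (mem_G_iff_of_mem_slab hz h1).2 (by rw [hmap]; exact Or.inl (by simpa using h2'))
    have hτ : (τ : ℂ) ≠ 0 := ofReal_ne_zero.2 h2'.ne'
    simp only [Function.comp]
    rw [hJL _ ⟨h1, hG⟩]
    simp only
    rw [hmap, mul_assoc, ← cpow_add _ _ hτ, add_neg_cancel, cpow_zero, mul_one]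
  · by_contra hL
    have h' : ExtendsAcross z m
        (fun w => (fun l => L * exp (l * α)) (log (I * (w - z m)))) := by
      obtain ⟨J, hJ, hJL⟩ := h
      refine ⟨J, hJ, fun w hw => ?_⟩
      rw [hJL w hw]
      simp only
      rw [cpow_def_of_ne_zero (slitPlane_ne_zero (hw.2 m).1)]
    have h1 := h'.eq_boundary_values hz hre (q := fun l => L * exp (l * α)) (by fun_prop)
    simp only [mul_right_inj' hL] at h1
    -- No jump means e^{πiα} = e^{-πiα}, which makes α an integer.
    obtain ⟨n, hn⟩ := exp_eq_exp_iff_exists_int.1 h1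
    refine hα n ?_
    have hpi : (2 * Real.pi * I : ℂ) ≠ 0 := two_pi_I_ne_zero
    refine mul_left_cancel₀ hpi ?_
    linear_combination hn

/-- A multiple of `u ^ n log u` extends across the cut only if it vanishes. -/
theorem extendsAcross_log_iff {z : Fin P → ℂ} (hz : ∀ p, 0 < (z p).im)
    (hre : StrictMono fun p => (z p).re) {m : Fin P} {n : ℕ} {r : ℂ} :
    ExtendsAcross z m (fun w => r * log (I * (w - z m)) * (I * (w - z m)) ^ n) ↔ r = 0 := by
  refine ⟨fun h => ?_, fun h => ⟨fun _ => 0, differentiableOn_const _, fun w _ => by simp [h]⟩⟩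
  have h' : ExtendsAcross z m (fun w => (fun l => r * l * exp l ^ n) (log (I * (w - z m)))) := by
    obtain ⟨J, hJ, hJL⟩ := h
    refine ⟨J, hJ, fun w hw => ?_⟩
    rw [hJL w hw]
    simp only
    rw [exp_log (slitPlane_ne_zero (hw.2 m).1)]
  have h1 := h'.eq_boundary_values hz hre (q := fun l => r * l * exp l ^ n) (by fun_prop)
  simp only [exp_neg, exp_pi_mul_I] at h1
  -- The left side is the jump of r u^n log u across the cut at u = -1.
  have h2 : r * (2 * Real.pi * I) * (-1) ^ n = 0 := by
    have : ((-1 : ℂ))⁻¹ = -1 := by norm_num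
    rw [this] at h1
    linear_combination h1
  simpa [Real.pi_ne_zero, I_ne_zero] using h2

/-! ### The residue, and the condition at each z_m. -/

/-- The residue of `K / (s - z₀) ^ (n + 1)` vanishes if and only if the `n`-th derivative does. -/
theorem hasResidue_zero_iff {D : Set ℂ} (hD : IsOpen D) {K : ℂ → ℂ} (hK : DifferentiableOn ℂ K D)
    {z₀ : ℂ} (hz₀ : z₀ ∈ D) (n : ℕ) :
    HasResidue (fun s => K s / (s - z₀) ^ (n + 1)) z₀ 0 ↔ iteratedDeriv n K z₀ = 0 := by
  obtain ⟨ρ, hρ, hρD⟩ := Metric.isOpen_iff.1 hD z₀ hz₀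
  have hint : ∀ᶠ r : ℝ in 𝓝[>] 0,
      (2 * Real.pi * I)⁻¹ * (∮ s in C(z₀, r), K s / (s - z₀) ^ (n + 1)) =
      (n.factorial : ℂ)⁻¹ * iteratedDeriv n K z₀ := by
    filter_upwards [Ioo_mem_nhdsGT hρ] with r hr
    have := (hK.mono ((Metric.closedBall_subset_ball hr.2).trans
      hρD)).circleIntegral_one_div_sub_center_pow_smul hr.1 n
    simp only [smul_eq_mul, one_div_mul_eq_div] at this
    rw [this, div_eq_mul_inv, mul_assoc (2 * Real.pi * I : ℂ),
      inv_mul_cancel_left₀ two_pi_I_ne_zero]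
  have hn : (n.factorial : ℂ)⁻¹ ≠ 0 := inv_ne_zero (by exact_mod_cast n.factorial_ne_zero)
  constructor
  · rintro ⟨-, h⟩
    obtain ⟨r, h1, h2⟩ := (h.and hint).exists
    rw [h1] at h2
    exact (mul_eq_zero.1 h2.symm).resolve_left hn
  · intro h
    refine ⟨?_, ?_⟩
    · filter_upwards [nhdsWithin_le_nhds (hD.mem_nhds hz₀), self_mem_nhdsWithin] with s hs hs'
      refine (hK.analyticAt (hD.mem_nhds hs)).fun_div (by fun_prop) ?_
      exact pow_ne_zero _ (sub_ne_zero.2 hs')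
    · filter_upwards [hint] with r hr
      rw [hr, h, mul_zero]

theorem Wplus_eq (ε : ℝ) (c z v : Fin P → ℂ) (lam : ℝ) {ell : ℂ → ℝ → ℂ} {Φ : ℂ → ℂ}
    (hΦ : ∀ x ∈ G z, contourIntegral (ell x) (integrand ε c z v lam) = Φ x) {x : ℂ} (hx : x ∈ G z) :
    Wplus ε c z v lam (ell x) x = -(I / ε) * exp (I * h c z lam x / ε) * Φ x := by
  rw [← hΦ x hx]
  rfl

/-- The extension of `W₊` across a cut in terms of the local form of the primitive. -/
theorem extendsAcross_Wplus_iff (ε : ℝ) (hε : 0 < ε) (c v : Fin P → ℂ) {z : Fin P → ℂ}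
    (hz : ∀ p, 0 < (z p).im) (lam : ℝ) {ell : ℂ → ℝ → ℂ} {Φ : ℂ → ℂ}
    (hΦ : ∀ x ∈ G z, contourIntegral (ell x) (integrand ε c z v lam) = Φ x) {m : Fin P}
    {k : ℂ} (hk : k ≠ 0) {χ E : ℂ → ℂ} (hE : DifferentiableOn ℂ E (slab z m))
    (h : ∀ w ∈ slab z m ∩ G z, k * Φ w = χ w + (I * (w - z m)) ^ (-(I * c m / ε)) * E w) :
    ExtendsAcross z m (fun x => Wplus ε c z v lam (ell x) x) ↔
      ExtendsAcross z m (fun w => χ w * (I * (w - z m)) ^ (I * c m / ε)) := by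
  have hε' : (ε : ℂ) ≠ 0 := ofReal_ne_zero.2 hε.ne'
  have hR : DifferentiableOn ℂ (fun w => -(I / ε) * (k * regularExp ε c z lam m w)⁻¹)
      (slab z m) := by
    refine DifferentiableOn.const_mul (DifferentiableOn.inv (DifferentiableOn.const_mul
      ((differentiableOn_regularExp ε c hz lam m).mono subset_union_right) _) ?_) _
    exact fun w _ => mul_ne_zero hk (regularExp_ne_zero ε c z lam m w)
  refine extendsAcross_iff_of_eq hR (fun w _ => ?_) hE fun w hw => ?_
  · exact mul_ne_zero (neg_ne_zero.2 (div_ne_zero I_ne_zero hε'))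
      (inv_ne_zero (mul_ne_zero hk (regularExp_ne_zero ε c z lam m w)))
  · have hu := slitPlane_ne_zero (hw.2 m).1
    have hQ := regularExp_ne_zero ε c z lam m w
    have hp : (I * (w - z m)) ^ (I * c m / ε) ≠ 0 := by
      rw [Ne, cpow_eq_zero_iff]
      exact fun h0 => hu h0.1
    -- The factor u^α of e^{ih/ε} cancels the u^{-α} in front of E, so E becomes a holomorphic
    -- summand and only χ u^α can obstruct the extension.
    have hexp : exp (I * BenjaminOno.h c z lam w / ε) =
        (regularExp ε c z lam m w)⁻¹ * (I * (w - z m)) ^ (I * c m / ε) := by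
      have h1 := exp_eq_regularExp_mul ε c z lam (ne_of_mem_G hw.2 m)
      have h2 : -I * BenjaminOno.h c z lam w / ε = -(I * BenjaminOno.h c z lam w / ε) := by ring
      rw [h2, exp_neg, cpow_neg] at h1
      rw [← inv_inv (exp _), h1, mul_inv, inv_inv]
    have hΦw : Φ w = k⁻¹ * (χ w + ((I * (w - z m)) ^ (I * c m / ε))⁻¹ * E w) := by
      rw [← cpow_neg, ← h w hw, inv_mul_cancel_left₀ hk]
    rw [Wplus_eq ε c z v lam hΦ hw.2, hexp, hΦw]
    field_simp

theorem mu_eq_of_eq_intCast {ε : ℝ} {c : Fin P → ℂ} {m : Fin P} {n : ℤ}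
    (hn : I * c m / ε = n) : mu ε c m = n := by
  rw [mu, hn]
  simp

theorem natCast_toNat_mu_add_one {ε : ℝ} {c : Fin P → ℂ} {m : Fin P}
    (hm : 0 ≤ (I * c m / ε).re) : (((mu ε c m + 1).toNat : ℕ) : ℤ) = mu ε c m + 1 := by
  have : 0 ≤ mu ε c m := Int.floor_nonneg.2 hm
  exact Int.toNat_of_nonneg (by omega)

/-- Exactly one of the three conditions is not vacuous. The power form applies with N = 0 when Re α
< 0 and with N = μ + 1 when Re α ≥ 0 and α is not an integer; the logarithmic form applies with n =
μ when α = μ. -/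
theorem extendsAcross_Wplus_iff_condition (ε : ℝ) (hε : 0 < ε) (c v : Fin P → ℂ) {z : Fin P → ℂ}
    (hz : ∀ p, 0 < (z p).im) (hre : StrictMono fun p => (z p).re) {lam : ℝ} (hlam : 0 < lam)
    {ell : ℂ → ℝ → ℂ} {Φ : ℂ → ℂ} (hd : ∀ w ∈ G z, HasDerivAt Φ (integrand ε c z v lam w) w)
    (hΦ0 : ∀ x γ, IsEllZero z γ x → Tendsto (fun t => Φ (γ t)) atBot (𝓝 0))
    (hΦ : ∀ x ∈ G z, contourIntegral (ell x) (integrand ε c z v lam) = Φ x)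
    (m : Fin P) {γ : ℝ → ℂ} (hγ : IsEllZero z γ (z m)) :
    ExtendsAcross z m (fun x => Wplus ε c z v lam (ell x) x) ↔
      ((I * c m / ε).re < 0 → contourIntegral γ
        (fun s => (I * (s - z m)) ^ (-(I * c m / ε) - 1) * H ε c z v lam m s) = 0) ∧
      (0 ≤ (I * c m / ε).re → omega ε c m ≠ 0 → contourIntegral γ
        (fun s => (I * (s - z m)) ^ (-omega ε c m) *
          iteratedDeriv (mu ε c m + 1).toNat (H ε c z v lam m) s) = 0) ∧
      (0 ≤ (I * c m / ε).re → omega ε c m = 0 →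
        HasResidue (fun s => H ε c z v lam m s / (s - z m) ^ (mu ε c m + 1)) (z m) 0) := by
  have hκ : 0 < lam / ε := div_pos hlam hε
  have hH := differentiableOn_H ε c v hz hre lam m
  have hHd := leftDecay_H ε c z v lam m
  have hd' : ∀ w ∈ G z, HasDerivAt Φ
      (-((I * (w - z m)) ^ (-(I * c m / ε) - 1) * H ε c z v lam m w)) w := fun w hw => by
    rw [← integrand_eq ε c v hz hre lam (ne_of_mem_G hw m)]
    exact hd w hw
  have power : ∀ N : ℕ, (∀ j < N, I * c m / ε ≠ (j : ℂ)) → (I * c m / ε).re < N →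
      ((I * c m / ε).re < 0 ∨ ∀ n : ℤ, I * c m / ε ≠ n) →
      (ExtendsAcross z m (fun x => Wplus ε c z v lam (ell x) x) ↔ contourIntegral γ
        (fun s => (I * (s - z m)) ^ (-(I * c m / ε - N) - 1) *
          iteratedDeriv N (H ε c z v lam m) s) = 0) := by
    intro N hN hN' hα
    obtain ⟨k, E, hk, hE, hkE⟩ := exists_local_form hz hre hH hκ hHd hd' hΦ0 hγ hN hN'
    rw [extendsAcross_Wplus_iff ε hε c v hz lam hΦ hk hE hkE,
      extendsAcross_cpow_iff hz hre hα]
  rcases lt_or_ge (I * c m / ε).re 0 with hneg | hpos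
  · have := power 0 (by simp) (by simpa using hneg) (Or.inl hneg)
    simp only [Nat.cast_zero, sub_zero, iteratedDeriv_zero] at this
    rw [this]
    exact ⟨fun h => ⟨fun _ => h, fun h' => absurd hneg h'.not_gt, fun h' => absurd hneg h'.not_gt⟩,
      fun h => h.1 hneg⟩
  have hcast := natCast_toNat_mu_add_one hpos
  by_cases hω : omega ε c m = 0
  · obtain ⟨n, (hn : mu ε c m = n)⟩ := Int.eq_ofNat_of_zero_le (Int.floor_nonneg.2 hpos)
    have hαn : I * c m / ε = n := by
      rw [omega, hn, sub_eq_zero] at hω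
      exact_mod_cast hω
    obtain ⟨k, E, hk, hE, hkE⟩ := exists_local_form_log hz hre hH hκ hHd hd' hΦ0 hαn
    have hres : HasResidue (fun s => H ε c z v lam m s / (s - z m) ^ (mu ε c m + 1)) (z m) 0 ↔
        iteratedDeriv n (H ε c z v lam m) (z m) = 0 := by
      rw [← hasResidue_zero_iff (isOpen_slab z m) (hH.mono subset_union_right)
        (mem_slab_of_re_eq hre (hz m) rfl) n, hn]
      norm_cast
    rw [extendsAcross_Wplus_iff ε hε c v hz lam hΦ hk hE hkE, hαn]
    simp only [cpow_natCast]
    rw [extendsAcross_log_iff hz hre, mul_eq_zero, or_iff_right (neg_ne_zero.2 I_ne_zero), ← hres]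
    rw [hαn] at hpos
    exact ⟨fun h => ⟨fun h' => absurd hpos h'.not_ge, fun _ h' => absurd hω h', fun _ _ => h⟩,
      fun h => h.2.2 hpos hω⟩
  · have hint : ∀ n : ℤ, I * c m / ε ≠ n := fun n hn => hω (by
      rw [omega, mu_eq_of_eq_intCast hn, hn, sub_self])
    have hcast' : (((mu ε c m + 1).toNat : ℕ) : ℂ) = mu ε c m + 1 := by exact_mod_cast hcast
    have hlt : (I * c m / ε).re < ((mu ε c m + 1).toNat : ℕ) := by
      have h1 : (((mu ε c m + 1).toNat : ℕ) : ℝ) = mu ε c m + 1 := by exact_mod_cast hcast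
      rw [h1]
      exact Int.lt_floor_add_one _
    have := power _ (fun j _ => by exact_mod_cast hint j) hlt (Or.inr hint)
    -- With N = μ + 1 the exponent N - α - 1 is μ - α = -ω.
    have e : -(I * c m / ε - ((mu ε c m + 1).toNat : ℕ)) - 1 = -omega ε c m := by
      rw [hcast', omega]; ring
    rw [e] at this
    rw [this]
    exact ⟨fun h => ⟨fun h' => absurd h' hpos.not_gt, fun _ _ => h, fun _ h' => absurd h' hω⟩,
      fun h => h.2.1 hpos hω⟩

end BenjaminOno

end

open BenjaminOno
theorem proposition3p1 {P : ℕ} (ε : ℝ) (hε : 0 < ε) (c z : Fin P → ℂ)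
    (hc : ∀ p, c p ≠ 0) (hz : ∀ p, 0 < (z p).im) (hre : StrictMono fun p => (z p).re)
    (hsum : ∑ p, (c p + starRingEnd ℂ (c p)) = 0)
    (lam : ℝ) (hlam : 0 < lam) (v : Fin P → ℂ)
    (ell : ℂ → ℝ → ℂ) (hell : ∀ x ∈ G z, IsEllZero z (ell x) x)
    (hellz : ∀ m, IsEllZero z (ell (z m)) (z m)) :
    AnalyticInUpperHalfPlane z (fun x => Wplus ε c z v lam (ell x) x) ↔
      ∀ m,
        ((I * c m / ε).re < 0 →
          contourIntegral (ell (z m))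
            (fun s => (I * (s - z m)) ^ (-(I * c m / ε) - 1) * H ε c z v lam m s) = 0) ∧
        (0 ≤ (I * c m / ε).re → omega ε c m ≠ 0 →
          contourIntegral (ell (z m))
            (fun s => (I * (s - z m)) ^ (-omega ε c m) *
              iteratedDeriv (mu ε c m + 1).toNat (H ε c z v lam m) s) = 0) ∧
        (0 ≤ (I * c m / ε).re → omega ε c m = 0 →
          HasResidue (fun s => H ε c z v lam m s / (s - z m) ^ (mu ε c m + 1)) (z m) 0) := by
  obtain ⟨Φ, hd, hΦ0, hΦ⟩ := exists_normalized_primitive ε hε c hz hlam v hell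
  have hW : DifferentiableOn ℂ (fun x => Wplus ε c z v lam (ell x) x) (G z) := by
    refine DifferentiableOn.congr (f := fun x => -(I / ε) * exp (I * h c z lam x / ε) * Φ x) ?_
      fun x hx => Wplus_eq ε c z v lam hΦ hx
    refine DifferentiableOn.mul (DifferentiableOn.const_mul
      (((differentiableOn_h c z lam).const_mul _).div_const _).cexp _) fun w hw => ?_
    exact (hd w hw).differentiableAt.differentiableWithinAt
  rw [analyticInUpperHalfPlane_iff hre hW]
  exact forall_congr' fun m => extendsAcross_Wplus_iff_condition ε hε c v hz hre hlam hd hΦ0 hΦ m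
    (hellz m)
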